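/- Let $\Gamma\subset\mathbb R^2$ be the union of finitely many pairwise disjoint finite curves $\Gamma_i=\gamma_i([0,L_i])$, $L_i>0$, where each $\gamma_i\colon[0,L_i]\to\mathbb R^2$ is a $C^2$ arc length parameterization without self-intersections: either $\gamma_i$ is injective on $[0,L_i]$, or $\Gamma_i$ is closed, i.e. $\gamma_i$ is injective on $[0,L_i)$ and $\gamma_i,\gamma_i',\gamma_i''$ each take the same value at $0$ and at $L_i$. Let $\sigma_\Gamma$ be the arc length measure on $\Gamma$, let $I\colon W^{1,2}(\mathbb R^2)\to L^2(\sigma_\Gamma)$ be the trace map (the continuous extension of the restriction $\varphi\mapsto\varphi|_\Gamma$, $\varphi\in C_c^\infty(\mathbb R^2)$), let $\alpha>0$, and let $H$ be the self-adjoint operator in $L^2(\mathbb R^2)$ associated with the form $$\mathcal E(\psi,\phi)=\int_{\mathbb R^2}\nabla\psi\cdot\overline{\nabla\phi}\,dx-\alpha\int_\Gamma (I\psi)\,\overline{(I\phi)}\,d\sigma_\Gamma,\qquad \psi,\phi\in W^{1,2}(\mathbb R^2),$$ that is, $H\psi=f$ if and only if $\psi\in W^{1,2}(\mathbb R^2)$,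 $f\in L^2(\mathbb R^2)$ and $\mathcal E(\psi,\phi)=\int f\,\overline\phi\,dx$ for all $\phi\in W^{1,2}(\mathbb R^2)$. A ground state is an eigenfunction of $H$ whose eigenvalue is the lowest eigenvalue of $H$. Let $u$ be a real-valued eigenfunction of $H$ with eigenvalue $E<0$. Then $u$ coincides almost everywhere with a (unique) continuous function $\psi\colon\mathbb R^2\to\mathbb R$, and: 1. Every point at which $\psi$ attains its global maximum, and every point at which $\psi$ attains its global minimum, lies on $\Gamma$. Every local maximum point at which $\psi$ is positive, and every local minimum point at which $\psi$ is negative, also lies on $\Gamma$. If $\psi$ takes a positive value, then $\psi$ attains its global maximum at a point of $\Gamma$; if $\psi$ takes a negative value, then $\psi$ attains its global minimum at a point of $\Gamma$. 2. If $u$ is not a ground state, then $\psi$ has at least one zero in the convex hull of $\Gamma$. -/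

import Mathlib

open MeasureTheory Filter Topology
open scoped ContDiff ENNReal

namespace LeakyCurve

/-- The Euclidean plane `ℝ²`. -/
abbrev Plane : Type := EuclideanSpace ℝ (Fin 2)

/-- A finite curve of class `C²` in the plane, parameterized by arc length on `[0, L]`, without
self-intersections. It is either an arc, or a closed curve; in the latter case the end points
coincide and the first two derivatives at the parameter values `0` and `L` coincide as well. -/
structure PlaneCurve where
  length : ℝ
  length_pos : 0 < length
  param : ℝ → Plane
  contDiffOn : ContDiffOn ℝ 2 param (Set.Icc 0 length)
  unit_speed : ∀ s ∈ Set.Icc 0 length, ‖derivWithin param (Set.Icc 0 length) s‖ = 1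
  simple :
    Set.InjOn param (Set.Icc 0 length) ∨
      (Set.InjOn param (Set.Ico 0 length) ∧
        param 0 = param length ∧
        derivWithin param (Set.Icc 0 length) 0 = derivWithin param (Set.Icc 0 length) length ∧
        derivWithin (derivWithin param (Set.Icc 0 length)) (Set.Icc 0 length) 0 =
          derivWithin (derivWithin param (Set.Icc 0 length)) (Set.Icc 0 length) length)

/-- The range of the curve, a subset of the plane. -/
def PlaneCurve.range (c : PlaneCurve) : Set Plane :=
  c.param '' Set.Icc 0 c.length

/-- The arc length measure of the curve, as a measure on the plane. The parameterization is by arc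
length and injective up to the end point, so this is the push-forward of Lebesgue measure. -/
noncomputable def PlaneCurve.arcMeasure (c : PlaneCurve) : Measure Plane :=
  Measure.map c.param (volume.restrict (Set.Icc 0 c.length))

/-- The set `Γ`, the union of finitely many curves (its components). -/
def support {n : ℕ} (c : Fin n → PlaneCurve) : Set Plane :=
  ⋃ i, (c i).range

/-- The measure `σ_Γ`, the arc length measure on `Γ`, for pairwise disjoint components. -/
noncomputable def surfaceMeasure {n : ℕ} (c : Fin n → PlaneCurve) : Measure Plane :=
  ∑ i, (c i).arcMeasure

/-- The partial derivative in the `i`-th coordinate direction. -/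
noncomputable def partialDeriv {F : Type*} [NormedAddCommGroup F] [NormedSpace ℝ F]
    (i : Fin 2) (φ : Plane → F) (x : Plane) : F :=
  fderiv ℝ φ x (EuclideanSpace.single i (1 : ℝ))

/-- `g` is the weak (distributional) `i`-th partial derivative of `u`. -/
def HasWeakPartialDeriv (i : Fin 2) (u g : Plane → ℂ) : Prop :=
  ∀ φ : Plane → ℂ, ContDiff ℝ ∞ φ → HasCompactSupport φ →
    ∫ x, u x * partialDeriv i φ x = - ∫ x, g x * φ x

/-- An element of the Sobolev space `W^{1,2}(ℝ²)` of complex-valued functions, together with its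
weak gradient (which is determined by the function almost everywhere). -/
structure W12 where
  toFun : Plane → ℂ
  grad : Fin 2 → Plane → ℂ
  memLp : MemLp toFun 2 volume
  memLp_grad : ∀ i, MemLp (grad i) 2 volume
  hasWeakPartialDeriv : ∀ i, HasWeakPartialDeriv i toFun (grad i)

/-- `t` is the trace of `u ∈ W^{1,2}(ℝ²)` in `L²(σ)`: the trace map is the extension by continuity
of the restriction map, defined on smooth functions of compact support. (For the arc length
measure `σ` of a regular curve the restriction map is bounded from `W^{1,2}` to `L²(σ)`, so that
the trace exists, and it is unique up to `σ`-null sets.) -/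
def IsTrace (σ : Measure Plane) (u : W12) (t : Plane → ℂ) : Prop :=
  MemLp t 2 σ ∧
    ∃ φ : ℕ → Plane → ℂ,
      (∀ k, ContDiff ℝ ∞ (φ k) ∧ HasCompactSupport (φ k)) ∧
      Tendsto (fun k => eLpNorm (fun x => φ k x - u.toFun x) 2 volume) atTop (𝓝 0) ∧
      (∀ i, Tendsto (fun k => eLpNorm (fun x => partialDeriv i (φ k) x - u.grad i x) 2 volume)
        atTop (𝓝 0)) ∧
      Tendsto (fun k => eLpNorm (fun x => φ k x - t x) 2 σ) atTop (𝓝 0)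

/-- The sesquilinear form
`𝓔(u, v) = ∫ ∇u · conj ∇v dx - α ∫ (trace of u) · conj (trace of v) dσ`, where `tu` and `tv` are
the traces of `u` and `v`. -/
noncomputable def energyForm (α : ℝ) (σ : Measure Plane) (u : W12) (tu : Plane → ℂ)
    (v : W12) (tv : Plane → ℂ) : ℂ :=
  (∫ x, ∑ i, u.grad i x * (starRingEnd ℂ) (v.grad i x)) -
    (α : ℂ) * ∫ x, tu x * (starRingEnd ℂ) (tv x) ∂σ

/-- The graph of the self-adjoint operator `H` in `L²(ℝ²)` associated with the form `𝓔` on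
`W^{1,2}(ℝ²)`: `u` lies in the domain of `H` and `H u = f` if and only if `u ∈ W^{1,2}`,
`f ∈ L²`, and `𝓔(u, v) = (f, v)` for all `v ∈ W^{1,2}`. -/
def HamiltonianGraph (α : ℝ) (σ : Measure Plane) (u f : Plane → ℂ) : Prop :=
  MemLp f 2 volume ∧
    ∃ (U : W12) (tU : Plane → ℂ), U.toFun = u ∧ IsTrace σ U tU ∧
      ∀ (v : W12) (tv : Plane → ℂ), IsTrace σ v tv →
        energyForm α σ U tU v tv = ∫ x, f x * (starRingEnd ℂ) (v.toFun x)

/-- `u` is an eigenfunction of `H` with the (necessarily real) eigenvalue `E`. -/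
def IsEigenfunction (α : ℝ) (σ : Measure Plane) (E : ℝ) (u : Plane → ℂ) : Prop :=
  HamiltonianGraph α σ u (fun x => (E : ℂ) * u x) ∧ ¬ (u =ᵐ[volume] 0)

/-- `u` is a ground state of `H`: an eigenfunction with the lowest eigenvalue of `H`. -/
def IsGroundState (α : ℝ) (σ : Measure Plane) (u : Plane → ℂ) : Prop :=
  ∃ E : ℝ, IsEigenfunction α σ E u ∧
    ∀ (E' : ℝ) (v : Plane → ℂ), IsEigenfunction α σ E' v → E ≤ E'

end LeakyCurve

namespace LeakyCurve

/-! Write `m = -E > 0` and let `G_m` be the positive Green function of `-Δ + m`. The eigenvalue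
equation says that `(-Δ + m) u` is the measure with density `α t` on `Γ`, where `t` is the trace of
`u`, so `u = α ∫ G_m(x - y) t(y) dσ(y)` almost everywhere (`ae_eq_potential`). The singularity of
`G_m` is weak enough, and arc length spread out enough, for the right side to be continuous and to
vanish at infinity. It is therefore uniformly continuous, its restriction to `Γ` is the trace
(`IsTrace.ae_eq_of_uniformContinuous`), and the representative `ψ` satisfies `ψ = α G_m ψ` with its
own boundary values (`exists_representative`).

Off `Γ` one has `Δψ = mψ` in the sense of distributions, so a positive local maximum there
contradicts the maximum principle (`mem_of_isLocalMax_of_pos`). A global maximum is positive: by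
decay it is at least `0`, and if `ψ ≤ 0` everywhere, then positivity of `G_m` makes `-ψ` positive
everywhere (`IsBoundState.pos_of_isMax`). Minima follow by passing to `-ψ`.

If `ψ` has no zero in the convex hull, which is connected, it has one sign on `Γ`, say positive. An
eigenfunction `φ` with `m' > m` would satisfy `|φ| ≤ α G_{m'} |φ|`. Integration against `ψ` and
symmetry of the kernel give `∫ |φ| (ψ - α G_{m'} ψ) dσ ≤ 0`, whereas `G_{m'} < G_m` makes the
bracket positive; hence `φ = 0` on `Γ`, and so everywhere (`IsBoundState.ae_eq_zero_of_lt`). No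
lower eigenvalue exists and `u` is a ground state. Neither simplicity of the lowest eigenvalue nor
any spectral theory enters. -/

/-! ### The Green function: positivity, monotonicity in `m`, bounds -/

/-- The heat kernel of the plane at time `τ`, damped by the factor `exp (-m τ)`. -/
noncomputable def dampedHeat (m τ : ℝ) (z : Plane) : ℝ :=
  Real.exp (-(m * τ)) * (4 * Real.pi * τ)⁻¹ * Real.exp (-(‖z‖ ^ 2 / (4 * τ)))

/-- The Green function of `-Δ + m` in the plane, as a superposition of heat kernels. -/
noncomputable def green (m : ℝ) (z : Plane) : ℝ :=
  ∫ τ in Set.Ioi 0, dampedHeat m τ z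

/-- The contribution of the times `τ > ε` to the Green function. -/
noncomputable def truncGreen (m ε : ℝ) (z : Plane) : ℝ :=
  ∫ τ in Set.Ioi ε, dampedHeat m τ z

/-- The time profile of the bound for the damped heat kernel. -/
noncomputable def heatWeight (m τ : ℝ) : ℝ := τ ^ (-(7 / 8) : ℝ) * Real.exp (-m * τ)

lemma dampedHeat_nonneg (m : ℝ) {τ : ℝ} (hτ : 0 < τ) (z : Plane) : 0 ≤ dampedHeat m τ z := by
  unfold dampedHeat; positivity

lemma dampedHeat_pos (m : ℝ) {τ : ℝ} (hτ : 0 < τ) (z : Plane) : 0 < dampedHeat m τ z := by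
  unfold dampedHeat; positivity

lemma dampedHeat_neg (m τ : ℝ) (z : Plane) : dampedHeat m τ (-z) = dampedHeat m τ z := by
  simp [dampedHeat]

lemma green_neg (m : ℝ) (z : Plane) : green m (-z) = green m z := by
  simp [green, dampedHeat_neg]

lemma green_sub_comm (m : ℝ) (x y : Plane) : green m (x - y) = green m (y - x) := by
  rw [← green_neg, neg_sub]

lemma heatWeight_nonneg (m : ℝ) {τ : ℝ} (hτ : 0 < τ) : 0 ≤ heatWeight m τ := by
  unfold heatWeight; positivity

lemma integrableOn_heatWeight {m : ℝ} (hm : 0 < m) :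
    IntegrableOn (heatWeight m) (Set.Ioi 0) := by
  have := integrableOn_rpow_mul_exp_neg_mul_rpow (p := 1) (s := -(7 / 8)) (b := m)
    (by norm_num) one_pos hm
  simp only [Real.rpow_one] at this
  exact this

lemma measurable_dampedHeat (m : ℝ) :
    Measurable (fun p : ℝ × Plane => dampedHeat m p.1 p.2) := by
  unfold dampedHeat; fun_prop

lemma measurable_dampedHeat_left (m : ℝ) (z : Plane) :
    Measurable (fun τ : ℝ => dampedHeat m τ z) := by
  unfold dampedHeat; fun_prop

/-- The inequality `exp (-s) ≤ s ^ (-1/8)` with `s = ‖z‖² / (4τ)` trades part of the singularity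
`τ⁻¹` for a singularity in `z`: `τ ^ (-7/8)` is integrable at `0`. The exponent is small enough that
even the square `‖z‖ ^ (-1/2)` of the spatial factor is integrable near `0` along a line. -/
lemma dampedHeat_le (m : ℝ) {τ : ℝ} (hτ : 0 < τ) {z : Plane} (hz : z ≠ 0) :
    dampedHeat m τ z ≤ heatWeight m τ * ‖z‖ ^ (-(1 / 4) : ℝ) := by
  have hz' : 0 < ‖z‖ := norm_pos_iff.2 hz
  set s : ℝ := ‖z‖ ^ 2 / (4 * τ) with hs
  have hs0 : 0 < s := by positivity
  have h1 : Real.exp (-s) ≤ s ^ (-(1 / 8) : ℝ) := by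
    rw [Real.exp_neg, Real.rpow_neg hs0.le]
    refine inv_anti₀ (by positivity) ?_
    calc s ^ (1 / 8 : ℝ) ≤ (s + 1) ^ (1 / 8 : ℝ) :=
          Real.rpow_le_rpow hs0.le (by linarith) (by norm_num)
      _ ≤ (s + 1) ^ (1 : ℝ) :=
          Real.rpow_le_rpow_of_exponent_le (by linarith) (by norm_num)
      _ ≤ Real.exp s := by rw [Real.rpow_one]; exact Real.add_one_le_exp s
  have h2 : s ^ (-(1 / 8) : ℝ) = ‖z‖ ^ (-(1 / 4) : ℝ) * (4 * τ) ^ (1 / 8 : ℝ) := by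
    rw [hs, Real.div_rpow (by positivity) (by positivity), ← Real.rpow_natCast,
      ← Real.rpow_mul hz'.le, Real.rpow_neg (by positivity : (0 : ℝ) ≤ 4 * τ), div_inv_eq_mul]
    norm_num
  have h3 : (4 * τ) ^ (1 / 8 : ℝ) ≤ 4 * τ ^ (1 / 8 : ℝ) := by
    rw [Real.mul_rpow (by norm_num) hτ.le]
    gcongr
    calc (4 : ℝ) ^ (1 / 8 : ℝ) ≤ 4 ^ (1 : ℝ) :=
          Real.rpow_le_rpow_of_exponent_le (by norm_num) (by norm_num)
      _ = 4 := Real.rpow_one 4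
  have h4 : (4 * Real.pi * τ)⁻¹ * (4 * τ ^ (1 / 8 : ℝ)) ≤ τ ^ (-(7 / 8) : ℝ) := by
    have : τ ^ (-(7 / 8) : ℝ) = τ ^ (1 / 8 : ℝ) * τ⁻¹ := by
      rw [← Real.rpow_neg_one τ, ← Real.rpow_add hτ]; norm_num
    rw [this]
    have hp : Real.pi⁻¹ ≤ 1 := inv_le_one_of_one_le₀ (by linarith [Real.pi_gt_three])
    have h : (4 * Real.pi * τ)⁻¹ * (4 * τ ^ (1 / 8 : ℝ))
        = Real.pi⁻¹ * (τ ^ (1 / 8 : ℝ) * τ⁻¹) := by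
      field_simp
    rw [h]
    exact mul_le_of_le_one_left (by positivity) hp
  calc dampedHeat m τ z = Real.exp (-(m * τ)) * (4 * Real.pi * τ)⁻¹ * Real.exp (-s) := rfl
    _ ≤ Real.exp (-(m * τ)) * (4 * Real.pi * τ)⁻¹ *
        (‖z‖ ^ (-(1 / 4) : ℝ) * (4 * τ ^ (1 / 8 : ℝ))) := by
        gcongr
        exact h1.trans (h2.le.trans (by gcongr))
    _ = Real.exp (-(m * τ)) * ((4 * Real.pi * τ)⁻¹ * (4 * τ ^ (1 / 8 : ℝ))) *
        ‖z‖ ^ (-(1 / 4) : ℝ) := by ring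
    _ ≤ Real.exp (-(m * τ)) * τ ^ (-(7 / 8) : ℝ) * ‖z‖ ^ (-(1 / 4) : ℝ) := by gcongr
    _ = heatWeight m τ * ‖z‖ ^ (-(1 / 4) : ℝ) := by unfold heatWeight; ring_nf

lemma integrableOn_dampedHeat {m : ℝ} (hm : 0 < m) {z : Plane} (hz : z ≠ 0) :
    IntegrableOn (fun τ => dampedHeat m τ z) (Set.Ioi 0) := by
  refine Integrable.mono' ((integrableOn_heatWeight hm).mul_const (‖z‖ ^ (-(1 / 4) : ℝ)))
    (measurable_dampedHeat_left m z).aestronglyMeasurable ?_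
  refine (ae_restrict_iff' measurableSet_Ioi).2 (ae_of_all _ fun τ hτ => ?_)
  rw [Real.norm_of_nonneg (dampedHeat_nonneg m hτ z)]
  exact dampedHeat_le m hτ hz

lemma green_nonneg (m : ℝ) (z : Plane) : 0 ≤ green m z :=
  setIntegral_nonneg measurableSet_Ioi fun _ hτ => dampedHeat_nonneg m hτ z

lemma green_pos {m : ℝ} (hm : 0 < m) {z : Plane} (hz : z ≠ 0) : 0 < green m z := by
  refine (setIntegral_pos_iff_support_of_nonneg_ae ?_ (integrableOn_dampedHeat hm hz)).2 ?_
  · exact (ae_restrict_iff' measurableSet_Ioi).2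
      (ae_of_all _ fun τ hτ => dampedHeat_nonneg m hτ z)
  · have : (Function.support fun τ => dampedHeat m τ z) ∩ Set.Ioi 0 = Set.Ioi 0 :=
      Set.inter_eq_right.2 fun τ hτ => (dampedHeat_pos m hτ z).ne'
    rw [this]; simp

/-- Only the factor `exp (-m τ)` depends on `m`, and it is strictly decreasing in `m` at every time.
-/
lemma green_strictAnti {m m' : ℝ} (hm : 0 < m) (hmm : m < m') {z : Plane} (hz : z ≠ 0) :
    green m' z < green m z := by
  rw [← sub_pos, green, green, ← integral_sub (integrableOn_dampedHeat hm hz)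
    (integrableOn_dampedHeat (hm.trans hmm) hz)]
  have key : ∀ τ ∈ Set.Ioi (0 : ℝ), 0 < dampedHeat m τ z - dampedHeat m' τ z := by
    intro τ hτ
    have hτ' : (0 : ℝ) < τ := hτ
    rw [sub_pos]
    unfold dampedHeat
    gcongr
  refine (setIntegral_pos_iff_support_of_nonneg_ae ?_ ((integrableOn_dampedHeat hm hz).sub
    (integrableOn_dampedHeat (hm.trans hmm) hz))).2 ?_
  · exact (ae_restrict_iff' measurableSet_Ioi).2 (ae_of_all _ fun τ hτ => (key τ hτ).le)
  · have : (Function.support ((fun τ => dampedHeat m τ z) - fun τ => dampedHeat m' τ z)) ∩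
        Set.Ioi 0 = Set.Ioi 0 :=
      Set.inter_eq_right.2 fun τ hτ => (key τ hτ).ne'
    rw [this]; simp

/-- The constant in the bound for the Green function. -/
noncomputable def greenConst (m : ℝ) : ℝ := ∫ τ in Set.Ioi 0, heatWeight m τ

lemma greenConst_nonneg (m : ℝ) : 0 ≤ greenConst m :=
  setIntegral_nonneg measurableSet_Ioi fun _ hτ => heatWeight_nonneg m hτ

lemma green_le {m : ℝ} (hm : 0 < m) {z : Plane} (hz : z ≠ 0) :
    green m z ≤ greenConst m * ‖z‖ ^ (-(1 / 4) : ℝ) := by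
  rw [greenConst, ← integral_mul_const]
  exact setIntegral_mono_on (integrableOn_dampedHeat hm hz)
    ((integrableOn_heatWeight hm).mul_const _) measurableSet_Ioi
    fun τ hτ => dampedHeat_le m hτ hz

lemma green_sub_truncGreen_nonneg {m : ℝ} (hm : 0 < m) {ε : ℝ} (hε : 0 < ε) {z : Plane}
    (hz : z ≠ 0) : 0 ≤ green m z - truncGreen m ε z := by
  rw [sub_nonneg]
  refine setIntegral_mono_set (integrableOn_dampedHeat hm hz) ?_
    (Set.Ioi_subset_Ioi hε.le).eventuallyLE
  exact (ae_restrict_iff' measurableSet_Ioi).2 (ae_of_all _ fun τ hτ => dampedHeat_nonneg m hτ z)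

/-- The error of truncation has the same spatial profile as the Green function, with a prefactor
that tends to `0` with `ε`. This makes truncated potentials converge uniformly. -/
lemma green_sub_truncGreen_le {m : ℝ} (hm : 0 < m) {ε : ℝ} (hε : 0 < ε) {z : Plane}
    (hz : z ≠ 0) :
    green m z - truncGreen m ε z ≤
      (∫ τ in Set.Ioc 0 ε, heatWeight m τ) * ‖z‖ ^ (-(1 / 4) : ℝ) := by
  have hsplit : green m z = (∫ τ in Set.Ioc 0 ε, dampedHeat m τ z) + truncGreen m ε z := by
    rw [green, truncGreen, ← Set.Ioc_union_Ioi_eq_Ioi hε.le]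
    refine setIntegral_union (Set.Ioc_disjoint_Ioi le_rfl) measurableSet_Ioi ?_ ?_
    · exact (integrableOn_dampedHeat hm hz).mono_set Set.Ioc_subset_Ioi_self
    · exact (integrableOn_dampedHeat hm hz).mono_set (Set.Ioi_subset_Ioi hε.le)
  rw [hsplit, add_sub_cancel_right, ← integral_mul_const]
  refine setIntegral_mono_on
    ((integrableOn_dampedHeat hm hz).mono_set Set.Ioc_subset_Ioi_self) ?_ measurableSet_Ioc
    fun τ hτ => dampedHeat_le m hτ.1 hz
  exact ((integrableOn_heatWeight hm).mono_set Set.Ioc_subset_Ioi_self).mul_const _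

lemma tendsto_setIntegral_heatWeight {m : ℝ} (hm : 0 < m) :
    Tendsto (fun k : ℕ => ∫ τ in Set.Ioc 0 (1 / ((k : ℝ) + 1)), heatWeight m τ) atTop (𝓝 0) := by
  have h := tendsto_setIntegral_of_antitone (μ := volume) (f := heatWeight m)
    (s := fun k : ℕ => Set.Ioc 0 (1 / ((k : ℝ) + 1))) (fun _ => measurableSet_Ioc) ?_
    ⟨0, (integrableOn_heatWeight hm).mono_set Set.Ioc_subset_Ioi_self⟩
  · have he : (⋂ k : ℕ, Set.Ioc 0 (1 / ((k : ℝ) + 1))) = ∅ := by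
      ext x
      simp only [Set.mem_iInter, Set.mem_Ioc, Set.mem_empty_iff_false, iff_false, not_forall]
      by_cases hx : 0 < x
      · obtain ⟨k, hk⟩ := exists_nat_one_div_lt hx
        exact ⟨k, fun h => absurd h.2 (not_le.2 hk)⟩
      · exact ⟨0, fun h => hx h.1⟩
    rwa [he, setIntegral_empty] at h
  · intro a b hab
    refine Set.Ioc_subset_Ioc_right ?_
    have : (a : ℝ) ≤ b := by exact_mod_cast hab
    exact one_div_le_one_div_of_le (by positivity) (by linarith)

lemma dampedHeat_le_of_lt (m : ℝ) {ε τ : ℝ} (hε : 0 < ε) (hτ : ε < τ) (z : Plane) :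
    dampedHeat m τ z ≤ ε⁻¹ * Real.exp (-m * τ) := by
  have hτ0 : 0 < τ := hε.trans hτ
  have h1 : (4 * Real.pi * τ)⁻¹ ≤ ε⁻¹ := by
    refine inv_anti₀ hε ?_
    nlinarith [Real.pi_gt_three]
  have h2 : Real.exp (-(‖z‖ ^ 2 / (4 * τ))) ≤ 1 := Real.exp_le_one_iff.2 (by
    have : 0 ≤ ‖z‖ ^ 2 / (4 * τ) := by positivity
    linarith)
  calc dampedHeat m τ z ≤ Real.exp (-(m * τ)) * ε⁻¹ * 1 := by unfold dampedHeat; gcongr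
    _ = _ := by ring_nf

lemma continuous_truncGreen {m : ℝ} (hm : 0 < m) {ε : ℝ} (hε : 0 < ε) :
    Continuous (truncGreen m ε) := by
  refine continuous_of_dominated (bound := fun τ => ε⁻¹ * Real.exp (-m * τ)) ?_ ?_ ?_ ?_
  · exact fun z => (measurable_dampedHeat_left m z).aestronglyMeasurable
  · refine fun z => (ae_restrict_iff' measurableSet_Ioi).2 (ae_of_all _ fun τ hτ => ?_)
    rw [Real.norm_of_nonneg (dampedHeat_nonneg m (hε.trans hτ) z)]
    exact dampedHeat_le_of_lt m hε hτ z
  · exact ((integrableOn_exp_mul_Ioi (by linarith : -m < 0) ε)).const_mul _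
  · refine (ae_of_all _ fun τ => ?_)
    unfold dampedHeat; fun_prop

lemma truncGreen_nonneg (m : ℝ) {ε : ℝ} (hε : 0 < ε) (z : Plane) : 0 ≤ truncGreen m ε z :=
  setIntegral_nonneg measurableSet_Ioi fun _ hτ => dampedHeat_nonneg m (hε.trans hτ) z

lemma truncGreen_le {m : ℝ} (hm : 0 < m) {ε : ℝ} (hε : 0 < ε) (z : Plane) :
    truncGreen m ε z ≤ ∫ τ in Set.Ioi ε, ε⁻¹ * Real.exp (-m * τ) := by
  have hi := ((integrableOn_exp_mul_Ioi (by linarith : -m < 0) ε)).const_mul ε⁻¹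
  refine setIntegral_mono_on ?_ hi measurableSet_Ioi fun τ hτ => dampedHeat_le_of_lt m hε hτ z
  refine Integrable.mono' hi (measurable_dampedHeat_left m z).aestronglyMeasurable ?_
  refine (ae_restrict_iff' measurableSet_Ioi).2 (ae_of_all _ fun τ hτ => ?_)
  rw [Real.norm_of_nonneg (dampedHeat_nonneg m (hε.trans hτ) z)]
  exact dampedHeat_le_of_lt m hε hτ z

lemma measurable_green (m : ℝ) : Measurable (green m) := by
  have : StronglyMeasurable fun z : Plane =>
      ∫ τ, dampedHeat m τ z ∂(volume.restrict (Set.Ioi (0 : ℝ))) := by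
    refine StronglyMeasurable.integral_prod_right (f := fun z τ => dampedHeat m τ z) ?_
    exact ((measurable_dampedHeat m).comp measurable_swap).stronglyMeasurable
  exact this.measurable

lemma integral_dampedHeat (m : ℝ) {τ : ℝ} (hτ : 0 < τ) (x : Plane) :
    ∫ y, dampedHeat m τ (x - y) = Real.exp (-(m * τ)) := by
  rw [integral_sub_left_eq_self (fun y => dampedHeat m τ y) volume x]
  have h := GaussianFourier.integral_rexp_neg_mul_sq_norm (V := Plane) (b := (4 * τ)⁻¹)
    (by positivity)
  unfold dampedHeat
  rw [integral_const_mul]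
  have h' : ∀ y : Plane, -(‖y‖ ^ 2 / (4 * τ)) = -(4 * τ)⁻¹ * ‖y‖ ^ 2 := by
    intro y; rw [div_eq_mul_inv]; ring
  simp_rw [h']
  rw [h]
  simp only [finrank_euclideanSpace, Fintype.card_fin, Nat.cast_ofNat, div_inv_eq_mul]
  norm_num
  field_simp

lemma integrable_dampedHeat (m : ℝ) {τ : ℝ} (hτ : 0 < τ) (x : Plane) :
    Integrable fun y => dampedHeat m τ (x - y) := by
  -- The Bochner integral of a non-integrable function is `0`, but this one equals an exponential.
  by_contra h
  have := integral_dampedHeat m hτ x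
  rw [integral_undef h] at this
  exact (Real.exp_pos _).ne this

/-! ### Single layer potentials of diffuse measures -/

/-- A measure without atoms whose potentials with the kernel `‖x - y‖ ^ (-1/2)` are bounded. -/
structure IsDiffuse (σ : Measure Plane) : Prop where
  singleton : ∀ x, σ {x} = 0
  bound : ∃ C : ℝ≥0∞, C ≠ ⊤ ∧ ∀ x, ∫⁻ y, ENNReal.ofReal (‖x - y‖ ^ (-(1 / 2) : ℝ)) ∂σ ≤ C

lemma IsDiffuse.ae_ne {σ : Measure Plane} (hσ : IsDiffuse σ) (x : Plane) :
    ∀ᵐ y ∂σ, x - y ≠ 0 := by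
  have : σ {y | ¬ (x - y ≠ 0)} = 0 := by
    convert hσ.singleton x using 2
    ext y
    simp [sub_eq_zero, eq_comm]
  exact this

lemma measurable_norm_sub_rpow (x : Plane) (p : ℝ) :
    Measurable fun y : Plane => ‖x - y‖ ^ p := by
  fun_prop

lemma IsDiffuse.exists_integral_le {σ : Measure Plane} (hσ : IsDiffuse σ) :
    ∃ C : ℝ, 0 ≤ C ∧ ∀ x, Integrable (fun y => ‖x - y‖ ^ (-(1 / 2) : ℝ)) σ ∧
      ∫ y, ‖x - y‖ ^ (-(1 / 2) : ℝ) ∂σ ≤ C := by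
  obtain ⟨C, hC, h⟩ := hσ.bound
  refine ⟨C.toReal, ENNReal.toReal_nonneg, fun x => ?_⟩
  have hm := (measurable_norm_sub_rpow x (-(1 / 2))).aestronglyMeasurable (μ := σ)
  have hn : 0 ≤ᵐ[σ] fun y => ‖x - y‖ ^ (-(1 / 2) : ℝ) := ae_of_all _ fun y => by positivity
  refine ⟨⟨hm, ?_⟩, ?_⟩
  · rw [hasFiniteIntegral_iff_ofReal hn]
    exact (h x).trans_lt hC.lt_top
  · rw [integral_eq_lintegral_of_nonneg_ae hn hm]
    exact ENNReal.toReal_mono hC (h x)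

/-- By `ab ≤ a² + b²` the kernel `‖x - y‖ ^ (-1/4)` is squared to the exponent `-1/2` that
diffuseness controls uniformly in `x`, while the density contributes its `L²` norm. -/
lemma IsDiffuse.exists_integral_mul_norm_le {F : Type*} [NormedAddCommGroup F]
    {σ : Measure Plane} (hσ : IsDiffuse σ)
    {t : Plane → F} (ht : MemLp t 2 σ) :
    ∃ K : ℝ, 0 ≤ K ∧ ∀ x, Integrable (fun y => ‖x - y‖ ^ (-(1 / 4) : ℝ) * ‖t y‖) σ ∧
      ∫ y, ‖x - y‖ ^ (-(1 / 4) : ℝ) * ‖t y‖ ∂σ ≤ K := by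
  obtain ⟨C, hC0, hC⟩ := hσ.exists_integral_le
  have ht2 : Integrable (fun y => ‖t y‖ ^ 2) σ := by
    simpa using ht.integrable_norm_pow (by norm_num)
  have hle : ∀ x y, ‖x - y‖ ^ (-(1 / 4) : ℝ) * ‖t y‖ ≤
      ‖x - y‖ ^ (-(1 / 2) : ℝ) + ‖t y‖ ^ 2 := by
    intro x y
    have h : ‖x - y‖ ^ (-(1 / 2) : ℝ) = (‖x - y‖ ^ (-(1 / 4) : ℝ)) ^ 2 := by
      rw [← Real.rpow_natCast, ← Real.rpow_mul (norm_nonneg _)]; norm_num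
    rw [h]
    nlinarith [sq_nonneg (‖x - y‖ ^ (-(1 / 4) : ℝ) - ‖t y‖),
      sq_nonneg (‖x - y‖ ^ (-(1 / 4) : ℝ)), sq_nonneg ‖t y‖]
  have hI : ∀ x, Integrable (fun y => ‖x - y‖ ^ (-(1 / 4) : ℝ) * ‖t y‖) σ := by
    intro x
    refine Integrable.mono' ((hC x).1.add ht2)
      ((measurable_norm_sub_rpow x _).aestronglyMeasurable.mul ht.1.norm)
      (ae_of_all _ fun y => ?_)
    rw [Real.norm_of_nonneg (by positivity)]
    exact hle x y
  refine ⟨C + ∫ y, ‖t y‖ ^ 2 ∂σ, by positivity, fun x => ⟨hI x, ?_⟩⟩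
  calc _ ≤ ∫ y, (‖x - y‖ ^ (-(1 / 2) : ℝ) + ‖t y‖ ^ 2) ∂σ :=
        integral_mono (hI x) ((hC x).1.add ht2) (hle x)
    _ = _ := integral_add (hC x).1 ht2
    _ ≤ _ := by gcongr; exact (hC x).2

variable {F : Type*} [NormedAddCommGroup F] [NormedSpace ℝ F]

/-- The single layer potential of the density `t` on `σ`. -/
noncomputable def potential (m : ℝ) (σ : Measure Plane) (t : Plane → F) (x : Plane) : F :=
  ∫ y, green m (x - y) • t y ∂σ

lemma measurable_green_sub (m : ℝ) (x : Plane) : Measurable fun y => green m (x - y) :=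
  (measurable_green m).comp (measurable_const.sub measurable_id)

lemma IsDiffuse.norm_green_smul_le {σ : Measure Plane} (hσ : IsDiffuse σ) {m : ℝ} (hm : 0 < m)
    (t : Plane → F) (x : Plane) :
    ∀ᵐ y ∂σ, ‖green m (x - y) • t y‖ ≤ greenConst m * (‖x - y‖ ^ (-(1 / 4) : ℝ) * ‖t y‖) := by
  filter_upwards [hσ.ae_ne x] with y hy
  rw [norm_smul, Real.norm_of_nonneg (green_nonneg _ _), ← mul_assoc]
  gcongr
  exact green_le hm hy

lemma IsDiffuse.integrable_green_smul {σ : Measure Plane} (hσ : IsDiffuse σ) {m : ℝ}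
    (hm : 0 < m) {t : Plane → F} (ht : MemLp t 2 σ) (x : Plane) :
    Integrable (fun y => green m (x - y) • t y) σ := by
  obtain ⟨K, -, hK⟩ := hσ.exists_integral_mul_norm_le ht
  exact Integrable.mono' ((hK x).1.const_mul (greenConst m))
    ((measurable_green_sub m x).aestronglyMeasurable.smul ht.1) (hσ.norm_green_smul_le hm t x)

lemma IsDiffuse.exists_integral_norm_green_smul_le {σ : Measure Plane} (hσ : IsDiffuse σ)
    {m : ℝ} (hm : 0 < m) {t : Plane → F} (ht : MemLp t 2 σ) :
    ∃ K : ℝ, ∀ x, ∫ y, ‖green m (x - y) • t y‖ ∂σ ≤ K := by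
  obtain ⟨K, -, hK⟩ := hσ.exists_integral_mul_norm_le ht
  refine ⟨greenConst m * K, fun x => ?_⟩
  calc _ ≤ ∫ y, greenConst m * (‖x - y‖ ^ (-(1 / 4) : ℝ) * ‖t y‖) ∂σ :=
        integral_mono_ae (hσ.integrable_green_smul hm ht x).norm ((hK x).1.const_mul _)
          (hσ.norm_green_smul_le hm t x)
    _ = _ := integral_const_mul _ _
    _ ≤ _ := mul_le_mul_of_nonneg_left (hK x).2 (greenConst_nonneg m)

/-- The potential is the uniform limit of potentials with the truncated kernels, which are bounded
and continuous. -/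
lemma IsDiffuse.continuous_potential {σ : Measure Plane} [IsFiniteMeasure σ]
    (hσ : IsDiffuse σ) {m : ℝ} (hm : 0 < m) {t : Plane → F} (ht : MemLp t 2 σ) :
    Continuous (potential m σ t) := by
  obtain ⟨K, hK0, hK⟩ := hσ.exists_integral_mul_norm_le ht
  have ht1 : Integrable t σ := ht.integrable (by norm_num)
  set ε : ℕ → ℝ := fun k => 1 / ((k : ℝ) + 1) with hε
  have hε0 : ∀ k, 0 < ε k := fun k => by positivity
  set A : ℕ → Plane → F := fun k x => ∫ y, truncGreen m (ε k) (x - y) • t y ∂σ with hA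
  have hbd : ∀ k x y, ‖truncGreen m (ε k) (x - y) • t y‖ ≤
      (∫ τ in Set.Ioi (ε k), (ε k)⁻¹ * Real.exp (-m * τ)) * ‖t y‖ := by
    intro k x y
    rw [norm_smul, Real.norm_of_nonneg (truncGreen_nonneg m (hε0 k) _)]
    gcongr
    exact truncGreen_le hm (hε0 k) _
  have hmeas : ∀ k x, AEStronglyMeasurable (fun y => truncGreen m (ε k) (x - y) • t y) σ := by
    intro k x
    exact ((continuous_truncGreen hm (hε0 k)).comp
      (continuous_const.sub continuous_id)).aestronglyMeasurable.smul ht.1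
  have hAc : ∀ k, Continuous (A k) := by
    intro k
    refine continuous_of_dominated (hmeas k) (fun x => ae_of_all _ (hbd k x))
      (ht1.norm.const_mul _) (ae_of_all _ fun y => ?_)
    exact ((continuous_truncGreen hm (hε0 k)).comp
      (continuous_id.sub continuous_const)).smul continuous_const
  have hAi : ∀ k x, Integrable (fun y => truncGreen m (ε k) (x - y) • t y) σ := fun k x =>
    Integrable.mono' (ht1.norm.const_mul _) (hmeas k x) (ae_of_all _ (hbd k x))
  have hdist : ∀ k x, dist (potential m σ t x) (A k x) ≤
      (∫ τ in Set.Ioc 0 (ε k), heatWeight m τ) * K := by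
    intro k x
    have hc : 0 ≤ ∫ τ in Set.Ioc 0 (ε k), heatWeight m τ :=
      setIntegral_nonneg measurableSet_Ioc fun τ hτ => heatWeight_nonneg m hτ.1
    rw [dist_eq_norm, potential, hA, ← integral_sub (hσ.integrable_green_smul hm ht x) (hAi k x)]
    calc _ ≤ ∫ y, (∫ τ in Set.Ioc 0 (ε k), heatWeight m τ) *
            (‖x - y‖ ^ (-(1 / 4) : ℝ) * ‖t y‖) ∂σ := by
          refine norm_integral_le_of_norm_le ((hK x).1.const_mul _) ?_
          filter_upwards [hσ.ae_ne x] with y hy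
          rw [← sub_smul, norm_smul,
            Real.norm_of_nonneg (green_sub_truncGreen_nonneg hm (hε0 k) hy), ← mul_assoc]
          gcongr
          exact green_sub_truncGreen_le hm (hε0 k) hy
      _ = _ := integral_const_mul _ _
      _ ≤ _ := mul_le_mul_of_nonneg_left (hK x).2 hc
  have hlim := (tendsto_setIntegral_heatWeight hm).mul_const K
  rw [zero_mul] at hlim
  have hunif : TendstoUniformly A (potential m σ t) atTop := by
    rw [Metric.tendstoUniformly_iff]
    intro e he
    filter_upwards [hlim.eventually (gt_mem_nhds he)] with k hk x
    exact (hdist k x).trans_lt hk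
  exact hunif.continuous (Eventually.of_forall hAc).frequently

/-- The polynomial bound on the Green function suffices: `‖x - y‖ ≥ ‖x‖ - R` when `Γ` lies in the
ball of radius `R`. -/
lemma IsDiffuse.tendsto_potential_cocompact {σ : Measure Plane} [IsFiniteMeasure σ]
    (hσ : IsDiffuse σ) {Γ : Set Plane} (hΓ : IsCompact Γ) (hσΓ : σ Γᶜ = 0)
    {m : ℝ} (hm : 0 < m) {t : Plane → F} (ht : MemLp t 2 σ) :
    Tendsto (potential m σ t) (cocompact Plane) (𝓝 0) := by
  obtain ⟨R, hR⟩ := hΓ.isBounded.exists_norm_le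
  have ht1 : Integrable t σ := ht.integrable (by norm_num)
  have hbd : ∀ x : Plane, R < ‖x‖ → ‖potential m σ t x‖ ≤
      (‖x‖ - R) ^ (-(1 / 4) : ℝ) * (greenConst m * ∫ y, ‖t y‖ ∂σ) := by
    intro x hx
    rw [← integral_const_mul, ← integral_const_mul]
    refine norm_integral_le_of_norm_le ((ht1.norm.const_mul _).const_mul _) ?_
    have hσΓ' : ∀ᵐ y ∂σ, y ∈ Γ := hσΓ
    filter_upwards [hσ.norm_green_smul_le hm t x, hσΓ'] with y hy hyΓ
    refine hy.trans ?_
    have h1 : ‖x‖ - R ≤ ‖x - y‖ := by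
      have := norm_sub_norm_le x y
      have := hR y hyΓ
      linarith
    have h2 : ‖x - y‖ ^ (-(1 / 4) : ℝ) ≤ (‖x‖ - R) ^ (-(1 / 4) : ℝ) :=
      Real.rpow_le_rpow_of_nonpos (by linarith) h1 (by norm_num)
    have h3 := greenConst_nonneg m
    calc _ ≤ greenConst m * ((‖x‖ - R) ^ (-(1 / 4) : ℝ) * ‖t y‖) := by gcongr
      _ = _ := by ring
  have hnorm : Tendsto (fun x : Plane => ‖x‖) (cocompact Plane) atTop :=
    tendsto_norm_cocompact_atTop
  refine squeeze_zero_norm' ((hnorm.eventually_gt_atTop R).mono hbd) ?_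
  have h4 : Tendsto (fun x : Plane => (‖x‖ - R) ^ (-(1 / 4) : ℝ)) (cocompact Plane) (𝓝 0) :=
    (tendsto_rpow_neg_atTop (by norm_num : (0 : ℝ) < 1 / 4)).comp
      (tendsto_atTop_add_const_right _ _ hnorm)
  simpa using h4.mul_const (greenConst m * ∫ y, ‖t y‖ ∂σ)

/-- This licenses Fubini both for `ν = volume`, in the derivation of the integral representation,
and for `ν = σ`, in the comparison of two energies. -/
lemma IsDiffuse.integrable_prod_green {𝕜 : Type*} [RCLike 𝕜] {σ : Measure Plane} [IsFiniteMeasure σ]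
    (hσ : IsDiffuse σ) {ν : Measure Plane} [SFinite ν] {m : ℝ} (hm : 0 < m)
    {t : Plane → 𝕜} (ht : MemLp t 2 σ) {f : Plane → 𝕜} (hf : Integrable f ν) :
    Integrable (fun p : Plane × Plane => f p.1 * (green m (p.1 - p.2) • t p.2)) (ν.prod σ) := by
  obtain ⟨K, hK⟩ := hσ.exists_integral_norm_green_smul_le hm ht
  have hmeas : AEStronglyMeasurable
      (fun p : Plane × Plane => f p.1 * (green m (p.1 - p.2) • t p.2)) (ν.prod σ) := by
    have hg : AEStronglyMeasurable (fun p : Plane × Plane => green m (p.1 - p.2)) (ν.prod σ) :=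
      ((measurable_green m).comp (measurable_fst.sub measurable_snd)).aestronglyMeasurable
    exact hf.1.comp_fst.mul (hg.smul ht.1.comp_snd)
  rw [integrable_prod_iff hmeas]
  refine ⟨ae_of_all _ fun x => (hσ.integrable_green_smul hm ht x).const_mul (f x), ?_⟩
  refine Integrable.mono' (hf.norm.mul_const K) hmeas.norm.integral_prod_right'
    (ae_of_all _ fun x => ?_)
  rw [Real.norm_of_nonneg (by positivity)]
  simp_rw [norm_mul]
  rw [integral_const_mul]
  exact mul_le_mul_of_nonneg_left (hK x) (norm_nonneg _)

/-! ### Arc length measure, localized to pieces with an expanding coordinate -/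

/-- The distribution of the `i`-th coordinate under `μ` has density at most `2`. -/
def CoordDominated (i : Fin 2) (μ : Measure Plane) : Prop :=
  μ.map (fun y : Plane => y i) ≤ (2 : ℝ≥0∞) • volume

lemma measurable_coord (i : Fin 2) : Measurable fun y : Plane => y i :=
  (EuclideanSpace.proj (𝕜 := ℝ) i).continuous.measurable

lemma CoordDominated.lintegral_le {i : Fin 2} {μ : Measure Plane} (h : CoordDominated i μ)
    {f : ℝ → ℝ≥0∞} (hf : Measurable f) : ∫⁻ y, f (y i) ∂μ ≤ 2 * ∫⁻ r, f r := by
  rw [← lintegral_map hf (measurable_coord i)]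
  calc _ ≤ ∫⁻ r, f r ∂((2 : ℝ≥0∞) • volume) := lintegral_mono' h le_rfl
    _ = _ := lintegral_smul_measure _ _

/-- The inverse of `g` is `2`-Lipschitz, so it enlarges one-dimensional Hausdorff measure, which is
Lebesgue measure on the line, by a factor of at most `2`. -/
lemma map_restrict_le_of_expanding {g : ℝ → ℝ} {J : Set ℝ} (hJ : MeasurableSet J)
    (hg : ContinuousOn g J) (h : ∀ s ∈ J, ∀ s' ∈ J, |s - s'| ≤ 2 * |g s - g s'|) :
    (volume.restrict J).map g ≤ (2 : ℝ≥0∞) • volume := by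
  have hgm : AEMeasurable g (volume.restrict J) := hg.aemeasurable hJ
  refine Measure.le_iff.2 fun A hA => ?_
  rw [Measure.map_apply_of_aemeasurable hgm hA, Measure.restrict_apply' hJ]
  have hinj : Set.InjOn g J := by
    intro s hs s' hs' he
    have := h s hs s' hs'
    rw [he, sub_self, abs_zero, mul_zero] at this
    exact sub_eq_zero.1 (abs_eq_zero.1 (le_antisymm this (abs_nonneg _)))
  set S := g ⁻¹' A ∩ J with hS
  have hlip : LipschitzOnWith 2 (Function.invFunOn g J) (g '' S) := by
    refine LipschitzOnWith.of_dist_le_mul ?_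
    rintro _ ⟨s, hs, rfl⟩ _ ⟨s', hs', rfl⟩
    rw [hinj.leftInvOn_invFunOn hs.2, hinj.leftInvOn_invFunOn hs'.2]
    exact h s hs.2 s' hs'.2
  have himg : Function.invFunOn g J '' (g '' S) = S := by
    rw [Set.image_image]
    refine (Set.image_congr fun s hs => hinj.leftInvOn_invFunOn hs.2).trans (Set.image_id' S)
  have hH := hlip.hausdorffMeasure_image_le (d := 1) zero_le_one
  rw [himg, hausdorffMeasure_real] at hH
  simp only [ENNReal.rpow_one] at hH
  refine hH.trans ?_
  have hsub : g '' S ⊆ A := by rintro _ ⟨s, hs, rfl⟩; exact hs.1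
  simp only [Measure.smul_apply, smul_eq_mul, ENNReal.coe_ofNat]
  gcongr

lemma PlaneCurve.continuousOn_param (c : PlaneCurve) :
    ContinuousOn c.param (Set.Icc 0 c.length) := c.contDiffOn.continuousOn

lemma PlaneCurve.aemeasurable_param (c : PlaneCurve) :
    AEMeasurable c.param (volume.restrict (Set.Icc 0 c.length)) :=
  c.continuousOn_param.aemeasurable measurableSet_Icc

lemma PlaneCurve.isCompact_range (c : PlaneCurve) : IsCompact c.range :=
  isCompact_Icc.image_of_continuousOn c.continuousOn_param

lemma exists_half_lt_abs_coord {v : Plane} (hv : ‖v‖ = 1) : ∃ i, 1 / 2 < |v i| := by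
  by_contra! h
  have h1 : ‖v‖ ^ 2 = v 0 ^ 2 + v 1 ^ 2 := by
    rw [EuclideanSpace.norm_sq_eq]; simp
  rw [hv] at h1
  have h2 : v 0 ^ 2 ≤ (1 / 2) ^ 2 := sq_le_sq' (abs_le.1 (h 0)).1 (abs_le.1 (h 0)).2
  have h3 : v 1 ^ 2 ≤ (1 / 2) ^ 2 := sq_le_sq' (abs_le.1 (h 1)).1 (abs_le.1 (h 1)).2
  linarith

/-- Near each parameter value one of the coordinates of the curve is expanding. -/
lemma PlaneCurve.exists_expanding (c : PlaneCurve) {s₀ : ℝ} (hs₀ : s₀ ∈ Set.Icc 0 c.length) :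
    ∃ δ > 0, ∃ i : Fin 2, ∀ s ∈ Set.Icc 0 c.length ∩ Metric.ball s₀ δ,
      ∀ s' ∈ Set.Icc 0 c.length ∩ Metric.ball s₀ δ,
        |s - s'| ≤ 2 * |c.param s i - c.param s' i| := by
  set I := Set.Icc 0 c.length with hI
  obtain ⟨i, hi⟩ := exists_half_lt_abs_coord (c.unit_speed s₀ hs₀)
  have hcont : ContinuousOn (derivWithin c.param I) I :=
    c.contDiffOn.continuousOn_derivWithin (uniqueDiffOn_Icc c.length_pos) (by norm_num)
  have hci : ContinuousOn (fun s => derivWithin c.param I s i) I :=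
    (EuclideanSpace.proj (𝕜 := ℝ) i).continuous.comp_continuousOn hcont
  -- The sign `e` makes the chosen coordinate increasing, so that a lower bound `1 / 2` on the
  -- derivative gives the expansion by the mean value theorem.
  obtain ⟨e, he, hei⟩ : ∃ e : ℝ, |e| = 1 ∧ 1 / 2 < e * derivWithin c.param I s₀ i := by
    rcases abs_cases (derivWithin c.param I s₀ i) with h | h
    · exact ⟨1, by simp, by rw [one_mul, ← h.1]; exact hi⟩
    · exact ⟨-1, by simp, by rw [neg_one_mul, ← h.1]; exact hi⟩
  have hev : ∀ᶠ s in 𝓝[I] s₀, 1 / 2 < e * derivWithin c.param I s i :=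
    ((continuousOn_const.mul hci) s₀ hs₀).eventually (lt_mem_nhds hei)
  obtain ⟨δ, hδ, hball⟩ := Metric.mem_nhdsWithin_iff.1 hev
  refine ⟨δ, hδ, i, ?_⟩
  set J := I ∩ Metric.ball s₀ δ with hJ
  have hJc : Convex ℝ J := (convex_Icc _ _).inter (convex_ball _ _)
  set g : ℝ → ℝ := fun s => e * c.param s i with hg
  have hgcont : ContinuousOn g J := continuousOn_const.mul
    (((EuclideanSpace.proj (𝕜 := ℝ) i).continuous.comp_continuousOn c.continuousOn_param).mono
      Set.inter_subset_left)
  have hderiv : ∀ s ∈ interior J, HasDerivAt g (e * derivWithin c.param I s i) s := by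
    intro s hs
    have hsI : s ∈ interior I := interior_mono Set.inter_subset_left hs
    have hd : DifferentiableWithinAt ℝ c.param I s :=
      (c.contDiffOn.differentiableOn (by norm_num)) s (interior_subset hsI)
    have hd' : HasDerivAt c.param (derivWithin c.param I s) s :=
      hd.hasDerivWithinAt.hasDerivAt (mem_interior_iff_mem_nhds.1 hsI)
    exact (((EuclideanSpace.proj (𝕜 := ℝ) i).hasFDerivAt).comp_hasDerivAt s hd').const_mul e
  have hmono : ∀ s ∈ J, ∀ s' ∈ J, s ≤ s' → 1 / 2 * (s' - s) ≤ g s' - g s := by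
    refine hJc.mul_sub_le_image_sub_of_le_deriv hgcont
      (fun s hs => (hderiv s hs).differentiableAt.differentiableWithinAt) fun s hs => ?_
    rw [(hderiv s hs).deriv]
    have hsJ := interior_subset hs
    exact (hball ⟨hsJ.2, hsJ.1⟩).le
  have habs : ∀ s s', |c.param s i - c.param s' i| = |g s - g s'| := by
    intro s s'
    rw [hg]
    simp only
    rw [← mul_sub, abs_mul, he, one_mul]
  intro s hs s' hs'
  rw [habs]
  rcases le_total s s' with h | h
  · rw [abs_sub_comm s, abs_sub_comm (g s), abs_of_nonneg (sub_nonneg.2 h)]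
    have := hmono s hs s' hs' h
    linarith [le_abs_self (g s' - g s)]
  · rw [abs_of_nonneg (sub_nonneg.2 h)]
    have := hmono s' hs' s hs h
    linarith [le_abs_self (g s - g s')]

/-- An induction principle: a property of measures that is local in a suitable sense holds for
the arc length measure if it holds for its pieces over which a coordinate is expanding. -/
lemma PlaneCurve.arcMeasure_induction (c : PlaneCurve) {Q : Measure Plane → Prop} (h0 : Q 0)
    (hmono : ∀ μ ν, μ ≤ ν → Q ν → Q μ) (hadd : ∀ μ ν, Q μ → Q ν → Q (μ + ν))
    (hgood : ∀ i μ, IsFiniteMeasure μ → μ ≤ c.arcMeasure → CoordDominated i μ → Q μ) :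
    Q c.arcMeasure := by
  set I := Set.Icc 0 c.length with hI
  have haem : ∀ B : Set ℝ, AEMeasurable c.param (volume.restrict (B ∩ I)) := fun B =>
    c.aemeasurable_param.mono_measure (Measure.restrict_mono Set.inter_subset_right le_rfl)
  -- Compactness of `I` reduces the claim to small neighbourhoods. The sets are intersected with `I`
  -- throughout because the parameterization is controlled only there.
  have key : Q ((volume.restrict (I ∩ I)).map c.param) := by
    refine isCompact_Icc.induction_on (p := fun B => Q ((volume.restrict (B ∩ I)).map c.param))
      ?_ ?_ ?_ ?_
    · simpa using h0
    · intro s t hst ht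
      exact hmono _ _ (Measure.map_mono_of_aemeasurable
        (Measure.restrict_mono (Set.inter_subset_inter_left I hst) le_rfl) (haem t)) ht
    · intro s t hs ht
      refine hmono _ _ ?_ (hadd _ _ hs ht)
      have hsum : AEMeasurable c.param
          (volume.restrict (s ∩ I) + volume.restrict (t ∩ I)) := (haem s).add_measure (haem t)
      calc _ ≤ (volume.restrict (s ∩ I) + volume.restrict (t ∩ I)).map c.param := by
            refine Measure.map_mono_of_aemeasurable ?_ hsum
            rw [Set.union_inter_distrib_right]
            exact Measure.restrict_union_le _ _
        _ = _ := by
            refine Measure.ext fun A hA => ?_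
            rw [Measure.map_apply_of_aemeasurable hsum hA, Measure.add_apply, Measure.add_apply,
              Measure.map_apply_of_aemeasurable (haem s) hA,
              Measure.map_apply_of_aemeasurable (haem t) hA]
    · intro s₀ hs₀
      obtain ⟨δ, hδ, i, h⟩ := c.exists_expanding hs₀
      refine ⟨I ∩ Metric.ball s₀ δ,
        inter_mem self_mem_nhdsWithin (mem_nhdsWithin_of_mem_nhds (Metric.ball_mem_nhds _ hδ)), ?_⟩
      have hJ : MeasurableSet (I ∩ Metric.ball s₀ δ) := measurableSet_Icc.inter measurableSet_ball
      have hJI : I ∩ Metric.ball s₀ δ ∩ I = I ∩ Metric.ball s₀ δ :=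
        Set.inter_eq_left.2 Set.inter_subset_left
      have hm := haem (I ∩ Metric.ball s₀ δ)
      rw [hJI] at hm ⊢
      have hle : volume.restrict (I ∩ Metric.ball s₀ δ) ≤ volume.restrict I :=
        Measure.restrict_mono Set.inter_subset_left le_rfl
      have : IsFiniteMeasure (volume.restrict (I ∩ Metric.ball s₀ δ)) :=
        isFiniteMeasure_of_le _ hle
      refine hgood i _ inferInstance
        (Measure.map_mono_of_aemeasurable hle c.aemeasurable_param) ?_
      rw [CoordDominated, AEMeasurable.map_map_of_aemeasurable
        (measurable_coord i).aemeasurable hm]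
      exact map_restrict_le_of_expanding hJ
        (((EuclideanSpace.proj (𝕜 := ℝ) i).continuous.comp_continuousOn c.continuousOn_param).mono
          Set.inter_subset_left) h
  rwa [Set.inter_self] at key

lemma surfaceMeasure_induction {n : ℕ} (c : Fin n → PlaneCurve) {Q : Measure Plane → Prop}
    (h0 : Q 0) (hmono : ∀ μ ν, μ ≤ ν → Q ν → Q μ) (hadd : ∀ μ ν, Q μ → Q ν → Q (μ + ν))
    (hgood : ∀ i μ, IsFiniteMeasure μ → μ ≤ surfaceMeasure c → CoordDominated i μ → Q μ) :
    Q (surfaceMeasure c) := by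
  refine Finset.sum_induction _ Q hadd h0 fun k _ => ?_
  refine (c k).arcMeasure_induction h0 hmono hadd fun i μ hfin hle hd => hgood i μ hfin ?_ hd
  exact hle.trans (Finset.single_le_sum (f := fun k => (c k).arcMeasure)
    (fun _ _ => Measure.zero_le _) (Finset.mem_univ k))

instance PlaneCurve.isFiniteMeasure_arcMeasure (c : PlaneCurve) :
    IsFiniteMeasure c.arcMeasure := by
  unfold PlaneCurve.arcMeasure; infer_instance

instance isFiniteMeasure_surfaceMeasure {n : ℕ} (c : Fin n → PlaneCurve) :
    IsFiniteMeasure (surfaceMeasure c) := by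
  unfold surfaceMeasure; infer_instance

lemma isCompact_support {n : ℕ} (c : Fin n → PlaneCurve) : IsCompact (support c) :=
  isCompact_iUnion fun i => (c i).isCompact_range

lemma surfaceMeasure_compl_support {n : ℕ} (c : Fin n → PlaneCurve) :
    surfaceMeasure c (support c)ᶜ = 0 := by
  have hms : MeasurableSet (support c)ᶜ := (isCompact_support c).measurableSet.compl
  rw [surfaceMeasure, Measure.finsetSum_apply]
  refine Finset.sum_eq_zero fun i _ => ?_
  rw [PlaneCurve.arcMeasure, Measure.map_apply_of_aemeasurable (c i).aemeasurable_param hms,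
    Measure.restrict_apply' measurableSet_Icc]
  have : (c i).param ⁻¹' (support c)ᶜ ∩ Set.Icc 0 (c i).length = ∅ := by
    rw [Set.eq_empty_iff_forall_notMem]
    rintro s ⟨hs, hsI⟩
    exact hs (Set.mem_iUnion.2 ⟨i, s, hsI, rfl⟩)
  rw [this, measure_empty]

lemma abs_coord_le_norm (v : Plane) (i : Fin 2) : |v i| ≤ ‖v‖ := by
  simpa using PiLp.norm_apply_le v i

/-! ### Arc length measure is diffuse -/

/-- The singular part of the kernel `|r| ^ (-1/2)` on the line. -/
noncomputable def localKernel (r : ℝ) : ℝ≥0∞ :=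
  (Set.Icc (-1 : ℝ) 1).indicator (fun r => ENNReal.ofReal (|r| ^ (-(1 / 2) : ℝ))) r

lemma measurable_localKernel : Measurable localKernel := by
  unfold localKernel
  exact Measurable.indicator (by fun_prop) measurableSet_Icc

lemma lintegral_localKernel_ne_top : ∫⁻ r, localKernel r ≠ ⊤ := by
  unfold localKernel
  rw [lintegral_indicator measurableSet_Icc]
  have h1 : IntegrableOn (fun r : ℝ => |r| ^ (-(1 / 2) : ℝ)) (Set.Icc (-1) 1) := by
    have hp : IntegrableOn (fun r : ℝ => |r| ^ (-(1 / 2) : ℝ)) (Set.Ioc 0 1) := by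
      have := (intervalIntegral.intervalIntegrable_rpow' (a := 0) (b := 1)
        (r := -(1 / 2)) (by norm_num)).1
      refine this.congr_fun (fun r hr => ?_) measurableSet_Ioc
      simp only [abs_of_pos hr.1]
    have hn : IntegrableOn (fun r : ℝ => |r| ^ (-(1 / 2) : ℝ)) (Set.Ico (-1) 0) := by
      have h := hp.comp_neg
      simpa using h
    have h0 : IntegrableOn (fun r : ℝ => |r| ^ (-(1 / 2) : ℝ)) {0} := by simp
    refine ((hn.union h0).union hp).mono_set ?_
    intro r hr
    rcases lt_trichotomy r 0 with h | h | h
    · exact Or.inl (Or.inl ⟨hr.1, h⟩)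
    · exact Or.inl (Or.inr h)
    · exact Or.inr ⟨h, hr.2⟩
  exact (h1.lintegral_lt_top).ne

/-- The value `⊤` at `v i = 0` is needed because `0 ^ (-1/2)` is `0` for real powers, so
`localKernel` vanishes there. This happens only on a null set in the application. -/
lemma ofReal_norm_rpow_le (v : Plane) (i : Fin 2) :
    ENNReal.ofReal (‖v‖ ^ (-(1 / 2) : ℝ)) ≤ localKernel (v i) + (if v i = 0 then ⊤ else 1) := by
  by_cases h0 : v i = 0
  · simp [h0]
  rw [if_neg h0]
  have hp : 0 < |v i| := abs_pos.2 h0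
  have hle : ‖v‖ ^ (-(1 / 2) : ℝ) ≤ |v i| ^ (-(1 / 2) : ℝ) :=
    Real.rpow_le_rpow_of_nonpos hp (abs_coord_le_norm v i) (by norm_num)
  by_cases h1 : |v i| ≤ 1
  · refine le_add_right ?_
    rw [localKernel, Set.indicator_of_mem (by exact abs_le.1 h1)]
    exact ENNReal.ofReal_le_ofReal hle
  · refine le_add_left ?_
    rw [← ENNReal.ofReal_one]
    refine ENNReal.ofReal_le_ofReal (hle.trans ?_)
    exact Real.rpow_le_one_of_one_le_of_nonpos (not_le.1 h1).le (by norm_num)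

lemma CoordDominated.measure_coord_eq {i : Fin 2} {μ : Measure Plane} (h : CoordDominated i μ)
    (a : ℝ) : μ {y | y i = a} = 0 := by
  have h1 : μ.map (fun y : Plane => y i) {a} ≤ 0 := (h {a}).trans (by simp)
  rw [Measure.map_apply (measurable_coord i) (measurableSet_singleton a)] at h1
  exact le_antisymm h1 bot_le

/-- Since `‖x - y‖ ≥ |x i - y i|` and the coordinate has bounded density, the bound reduces to
integrability of `|r| ^ (-1/2)` on `[-1, 1]`. Outside this interval the kernel is at most `1` and
contributes at most the total mass. -/
lemma CoordDominated.isDiffuse {i : Fin 2} {μ : Measure Plane} [IsFiniteMeasure μ]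
    (h : CoordDominated i μ) : IsDiffuse μ := by
  refine ⟨fun x => measure_mono_null (fun y hy => ?_) (h.measure_coord_eq (x i)),
    2 * (∫⁻ r, localKernel r) + μ Set.univ, ?_, fun x => ?_⟩
  · rw [Set.mem_singleton_iff.1 hy]; rfl
  · exact ENNReal.add_ne_top.2
      ⟨ENNReal.mul_ne_top (by simp) lintegral_localKernel_ne_top, measure_ne_top _ _⟩
  · have hae : ∀ᵐ y ∂μ, ENNReal.ofReal (‖x - y‖ ^ (-(1 / 2) : ℝ)) ≤
        localKernel (x i - y i) + 1 := by
      have hne : ∀ᵐ y ∂μ, ¬ (y i = x i) := by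
        rw [ae_iff]; simpa using h.measure_coord_eq (x i)
      filter_upwards [hne] with y hy
      have := ofReal_norm_rpow_le (x - y) i
      rwa [PiLp.sub_apply, if_neg (sub_ne_zero.2 fun e => hy e.symm)] at this
    calc _ ≤ ∫⁻ y, (localKernel (x i - y i) + 1) ∂μ := lintegral_mono_ae hae
      _ = ∫⁻ y, localKernel (x i - y i) ∂μ + μ Set.univ := by
          rw [lintegral_add_right _ measurable_const, lintegral_const, one_mul]
      _ ≤ 2 * (∫⁻ r, localKernel (x i - r)) + μ Set.univ := by
          gcongr
          exact h.lintegral_le (f := fun r => localKernel (x i - r))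
            (measurable_localKernel.comp (measurable_const.sub measurable_id))
      _ = _ := by
          rw [lintegral_sub_left_eq_self (μ := volume) localKernel (x i)]

lemma isDiffuse_surfaceMeasure {n : ℕ} (c : Fin n → PlaneCurve) :
    IsDiffuse (surfaceMeasure c) := by
  refine surfaceMeasure_induction c ⟨by simp, 0, by simp, by simp⟩ ?_ ?_
    fun i μ hfin _ hd => hd.isDiffuse
  · rintro μ ν hle ⟨h1, C, hC, h2⟩
    exact ⟨fun x => le_antisymm ((hle {x}).trans (h1 x).le) bot_le, C, hC,
      fun x => (lintegral_mono' hle le_rfl).trans (h2 x)⟩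
  · rintro μ ν ⟨h1, C, hC, h2⟩ ⟨h1', C', hC', h2'⟩
    refine ⟨fun x => by simp [h1, h1'], C + C', ENNReal.add_ne_top.2 ⟨hC, hC'⟩, fun x => ?_⟩
    rw [lintegral_add_measure]
    exact add_le_add (h2 x) (h2' x)

/-! ### The trace of a function with a uniformly continuous representative -/

/-- The `i`-th standard basis vector of the plane. -/
noncomputable abbrev basisVec (i : Fin 2) : Plane := EuclideanSpace.single i (1 : ℝ)

lemma measurePreserving_coordinates {i j : Fin 2} (hij : i ≠ j) :
    MeasurePreserving (fun p : ℝ × ℝ => p.1 • basisVec i + p.2 • basisVec j) := by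
  have h01 : MeasurePreserving (fun p : ℝ × ℝ => p.1 • basisVec 0 + p.2 • basisVec 1) := by
    have h := (EuclideanSpace.volume_preserving_symm_measurableEquiv_toLp (Fin 2)).symm.comp
      (volume_preserving_finTwoArrow ℝ).symm
    refine (congrArg (MeasurePreserving · volume volume) ?_).mp h
    funext p
    ext k
    fin_cases k <;> simp [MeasurableEquiv.finTwoArrow]
  have h10 : MeasurePreserving (fun p : ℝ × ℝ => p.1 • basisVec 1 + p.2 • basisVec 0) := by
    have h := h01.comp (Measure.measurePreserving_swap (μ := (volume : Measure ℝ))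
      (ν := (volume : Measure ℝ)))
    refine (congrArg (MeasurePreserving · volume volume) ?_).mp h
    funext p
    simp [add_comm]
  fin_cases i <;> fin_cases j
  · exact absurd rfl hij
  · exact h01
  · exact h10
  · exact absurd rfl hij

lemma eq_coord_smul_add {i j : Fin 2} (hij : i ≠ j) (y : Plane) :
    y = y i • basisVec i + y j • basisVec j := by
  ext k
  fin_cases i <;> fin_cases j <;> fin_cases k <;> simp_all

/-- Smearing a measure with dominated `i`-th coordinate along the other coordinate direction. -/
lemma CoordDominated.lintegral_lintegral_le {i j : Fin 2} (hij : i ≠ j) {μ : Measure Plane}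
    (h : CoordDominated i μ) {f : Plane → ℝ≥0∞} (hf : Measurable f) :
    ∫⁻ y, (∫⁻ r : ℝ, f (y + r • basisVec j)) ∂μ ≤ 2 * ∫⁻ x, f x := by
  set f₁ : ℝ → ℝ≥0∞ := fun a => ∫⁻ r : ℝ, f (a • basisVec i + r • basisVec j) with hf₁
  have hm : Measurable fun p : ℝ × ℝ => f (p.1 • basisVec i + p.2 • basisVec j) :=
    hf.comp (measurePreserving_coordinates hij).measurable
  have h1 : ∀ y : Plane, ∫⁻ r : ℝ, f (y + r • basisVec j) = f₁ (y i) := by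
    intro y
    rw [hf₁]
    simp only
    -- Translation by `y j` along the direction `j` shows that the inner integral depends on `y i`
    -- alone, which has bounded density.
    rw [← lintegral_add_left_eq_self (μ := (volume : Measure ℝ))
      (fun r => f (y i • basisVec i + r • basisVec j)) (y j)]
    refine lintegral_congr fun r => ?_
    congr 1
    conv_lhs => rw [eq_coord_smul_add hij y]
    rw [add_smul, add_assoc]
  simp_rw [h1]
  refine (h.lintegral_le hm.lintegral_prod_right').trans_eq ?_
  rw [← (measurePreserving_coordinates hij).lintegral_comp hf, Measure.volume_eq_prod,
    lintegral_prod _ hm.aemeasurable]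

/-- Cauchy–Schwarz on the product of `μ` with the segment, followed by the smearing bound for
`‖f‖²`. The gain is the factor `δ ^ (1/2)`. -/
lemma CoordDominated.lintegral_strip_le {i j : Fin 2} (hij : i ≠ j) {μ : Measure Plane}
    [IsFiniteMeasure μ] (h : CoordDominated i μ) {f : Plane → ℂ} (hf : Continuous f) (δ : ℝ) :
    ∫⁻ y, (∫⁻ r in Set.Ioo 0 δ, ‖f (y + r • basisVec j)‖ₑ) ∂μ ≤
      (2 : ℝ≥0∞) ^ (1 / 2 : ℝ) * eLpNorm f 2 volume *
        (μ Set.univ * ENNReal.ofReal δ) ^ (1 / 2 : ℝ) := by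
  set ν := μ.prod (volume.restrict (Set.Ioo 0 δ)) with hν
  have hF : Continuous fun p : Plane × ℝ => f (p.1 + p.2 • basisVec j) := by fun_prop
  have h1 : ∫⁻ y, (∫⁻ r in Set.Ioo 0 δ, ‖f (y + r • basisVec j)‖ₑ) ∂μ =
      eLpNorm (fun p : Plane × ℝ => f (p.1 + p.2 • basisVec j)) 1 ν := by
    rw [eLpNorm_one_eq_lintegral_enorm, hν, lintegral_prod _ hF.enorm.measurable.aemeasurable]
  have h2 : ν Set.univ = μ Set.univ * ENNReal.ofReal δ := by
    rw [hν, ← Set.univ_prod_univ, Measure.prod_prod, Measure.restrict_apply_univ, Real.volume_Ioo, sub_zero]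
  rw [h1, ← h2]
  have h3 := eLpNorm_le_eLpNorm_mul_rpow_measure_univ (μ := ν) (p := 1) (q := 2)
    (by norm_num) hF.aestronglyMeasurable
  refine h3.trans ?_
  have h4 : (1 / (1 : ℝ≥0∞).toReal - 1 / (2 : ℝ≥0∞).toReal) = 1 / 2 := by norm_num
  rw [h4]
  gcongr
  rw [eLpNorm_eq_lintegral_rpow_enorm_toReal (by norm_num) (by norm_num),
    eLpNorm_eq_lintegral_rpow_enorm_toReal (by norm_num) (by norm_num)]
  simp only [ENNReal.toReal_ofNat, ENNReal.rpow_ofNat]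
  rw [← ENNReal.mul_rpow_of_nonneg _ _ (by norm_num)]
  gcongr
  rw [hν, lintegral_prod _ (by fun_prop)]
  refine le_trans (lintegral_mono fun y => ?_) (h.lintegral_lintegral_le hij (f := fun x =>
    ‖f x‖ₑ ^ 2) (by fun_prop))
  exact setLIntegral_le_lintegral _ _

lemma enorm_sub_le_lintegral_partialDeriv {φ : Plane → ℂ} (hφ : ContDiff ℝ ∞ φ) (j : Fin 2)
    (y : Plane) {δ r : ℝ} (hr : r ∈ Set.Ioo 0 δ) :
    ‖φ y - φ (y + r • basisVec j)‖ₑ ≤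
      ∫⁻ ρ in Set.Ioo 0 δ, ‖partialDeriv j φ (y + ρ • basisVec j)‖ₑ := by
  have hd : ∀ ρ : ℝ, HasDerivAt (fun ρ : ℝ => φ (y + ρ • basisVec j))
      (partialDeriv j φ (y + ρ • basisVec j)) ρ := by
    intro ρ
    have h1 : HasFDerivAt φ (fderiv ℝ φ (y + ρ • basisVec j)) (y + ρ • basisVec j) :=
      (hφ.differentiable (by simp) _).hasFDerivAt
    have h2 : HasDerivAt (fun ρ : ℝ => y + ρ • basisVec j) (basisVec j) ρ := by
      simpa using ((hasDerivAt_id ρ).smul_const (basisVec j)).const_add y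
    exact h1.comp_hasDerivAt ρ h2
  have hc : Continuous fun ρ : ℝ => partialDeriv j φ (y + ρ • basisVec j) := by
    have : Continuous (partialDeriv j φ) := (hφ.continuous_fderiv (by simp)).clm_apply
      continuous_const
    fun_prop
  have hi := intervalIntegral.integral_eq_sub_of_hasDerivAt (a := 0) (b := r)
    (fun ρ _ => hd ρ) (hc.intervalIntegrable _ _)
  rw [zero_smul, add_zero] at hi
  rw [← enorm_neg, neg_sub, ← hi, intervalIntegral.integral_of_le hr.1.le]
  refine (enorm_integral_le_lintegral_enorm _).trans ?_
  exact lintegral_mono_set fun ρ hρ => ⟨hρ.1, hρ.2.trans_lt hr.2⟩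

lemma continuous_partialDeriv {φ : Plane → ℂ} (hφ : ContDiff ℝ ∞ φ) (j : Fin 2) :
    Continuous (partialDeriv j φ) :=
  (hφ.continuous_fderiv (by simp)).clm_apply continuous_const

/-- Comparison of a smooth function with the average of a continuous one over short segments. -/
lemma CoordDominated.lintegral_sub_le {i j : Fin 2} (hij : i ≠ j) {μ : Measure Plane}
    [IsFiniteMeasure μ] (h : CoordDominated i μ) {φ ψ t : Plane → ℂ} (hφ : ContDiff ℝ ∞ φ)
    (hψ : Continuous ψ) (ht : AEStronglyMeasurable t μ) {δ e : ℝ}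
    (he : ∀ (y : Plane), ∀ r ∈ Set.Ioo 0 δ, ‖ψ (y + r • basisVec j) - ψ y‖ ≤ e) :
    ENNReal.ofReal δ * ∫⁻ y, ‖t y - ψ y‖ₑ ∂μ ≤
      ENNReal.ofReal δ * eLpNorm (fun y => φ y - t y) 1 μ +
      ENNReal.ofReal δ * ((2 : ℝ≥0∞) ^ (1 / 2 : ℝ) * eLpNorm (partialDeriv j φ) 2 volume *
        (μ Set.univ * ENNReal.ofReal δ) ^ (1 / 2 : ℝ)) +
      (2 : ℝ≥0∞) ^ (1 / 2 : ℝ) * eLpNorm (fun x => φ x - ψ x) 2 volume *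
        (μ Set.univ * ENNReal.ofReal δ) ^ (1 / 2 : ℝ) +
      ENNReal.ofReal δ * (ENNReal.ofReal e * μ Set.univ) := by
  have hvol : volume (Set.Ioo 0 δ) = ENNReal.ofReal δ := by rw [Real.volume_Ioo, sub_zero]
  have hφc : Continuous φ := hφ.continuous
  set D : Plane → ℝ≥0∞ := fun y =>
    ∫⁻ ρ in Set.Ioo 0 δ, ‖partialDeriv j φ (y + ρ • basisVec j)‖ₑ with hD
  set S : Plane → ℝ≥0∞ := fun y =>
    ∫⁻ r in Set.Ioo 0 δ, ‖φ (y + r • basisVec j) - ψ (y + r • basisVec j)‖ₑ with hS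
  -- The splitting goes from `t y` to `φ y`, to `φ` and then `ψ` at the shifted point, and back to
  -- `ψ y`; it is integrated over the shift `r ∈ (0, δ)`. Only after this averaging can an `L²`
  -- bound on the plane control `φ - ψ`. Keeping the factor `δ` avoids division in `ℝ≥0∞`.
  have hpt : ∀ y, ENNReal.ofReal δ * ‖t y - ψ y‖ₑ ≤ ENNReal.ofReal δ * ‖φ y - t y‖ₑ +
      ENNReal.ofReal δ * D y + S y + ENNReal.ofReal δ * ENNReal.ofReal e := by
    intro y
    have hconst : ∀ a : ℝ≥0∞, ENNReal.ofReal δ * a = ∫⁻ _r in Set.Ioo 0 δ, a := by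
      intro a; rw [setLIntegral_const, hvol, mul_comm]
    rw [hconst, hconst, hconst (D y), hconst (ENNReal.ofReal e), hS,
      ← lintegral_add_right _ measurable_const,
      ← lintegral_add_left (by fun_prop), ← lintegral_add_right _ measurable_const]
    refine setLIntegral_mono' measurableSet_Ioo fun r hr => ?_
    have hsplit : t y - ψ y = -(φ y - t y) + (φ y - φ (y + r • basisVec j)) +
        (φ (y + r • basisVec j) - ψ (y + r • basisVec j)) + (ψ (y + r • basisVec j) - ψ y) := by
      ring
    rw [hsplit]
    refine (enorm_add_le _ _).trans (add_le_add ((enorm_add_le _ _).trans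
      (add_le_add ((enorm_add_le _ _).trans (add_le_add ?_ ?_)) le_rfl)) ?_)
    · rw [enorm_neg]
    · exact enorm_sub_le_lintegral_partialDeriv hφ j y hr
    · rw [← ofReal_norm]
      exact ENNReal.ofReal_le_ofReal (he y r hr)
  have hDm : Measurable D := by
    have : Continuous fun p : Plane × ℝ => partialDeriv j φ (p.1 + p.2 • basisVec j) := by
      have := continuous_partialDeriv hφ j
      fun_prop
    exact this.enorm.measurable.lintegral_prod_right'
  have hSm : Measurable S := by
    have : Continuous fun p : Plane × ℝ =>
        φ (p.1 + p.2 • basisVec j) - ψ (p.1 + p.2 • basisVec j) := by fun_prop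
    exact this.enorm.measurable.lintegral_prod_right'
  have htm : AEMeasurable (fun y => ‖φ y - t y‖ₑ) μ :=
    (hφc.aestronglyMeasurable.sub ht).enorm
  rw [← lintegral_const_mul' _ _ ENNReal.ofReal_ne_top]
  refine (lintegral_mono hpt).trans ?_
  rw [lintegral_add_right _ measurable_const, lintegral_add_right _ hSm,
    lintegral_add_right _ (hDm.const_mul _), lintegral_const_mul' _ _ ENNReal.ofReal_ne_top,
    lintegral_const_mul' _ _ ENNReal.ofReal_ne_top, lintegral_const,
    eLpNorm_one_eq_lintegral_enorm, mul_assoc (ENNReal.ofReal δ) (ENNReal.ofReal e)]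
  gcongr
  · exact h.lintegral_strip_le hij (continuous_partialDeriv hφ j) δ
  · exact h.lintegral_strip_le hij (hφc.sub hψ) δ

/-- The trace of a Sobolev function with a uniformly continuous representative is the
restriction of the representative, on pieces over which a coordinate is dominated. -/
lemma CoordDominated.ae_eq_of_isTrace {i : Fin 2} {μ σ : Measure Plane} [IsFiniteMeasure μ]
    (h : CoordDominated i μ) (hμσ : μ ≤ σ) {U : W12} {t : Plane → ℂ} (hU : IsTrace σ U t)
    {ψ : Plane → ℂ} (hψ : UniformContinuous ψ) (hψU : ψ =ᵐ[volume] U.toFun) :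
    ∀ᵐ y ∂μ, t y = ψ y := by
  obtain ⟨j, hij⟩ : ∃ j, i ≠ j := ⟨i + 1, by fin_cases i <;> simp⟩
  obtain ⟨ht, φ, hφ, hφU, hφg, hφt⟩ := hU
  have htμ : AEStronglyMeasurable t μ := ht.1.mono_measure hμσ
  set X := ∫⁻ y, ‖t y - ψ y‖ₑ ∂μ with hX
  set M := eLpNorm (U.grad j) 2 volume + 1 with hM
  have hM_ne : M ≠ ⊤ := ENNReal.add_ne_top.2 ⟨(U.memLp_grad j).2.ne, by simp⟩
  have ha : Tendsto (fun k => eLpNorm (fun y => φ k y - t y) 1 μ) atTop (𝓝 0) := by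
    have hle : ∀ k, eLpNorm (fun y => φ k y - t y) 1 μ ≤
        eLpNorm (fun y => φ k y - t y) 2 σ * μ Set.univ ^ (1 / 2 : ℝ) := by
      intro k
      have hm : AEStronglyMeasurable (fun y => φ k y - t y) μ :=
        (hφ k).1.continuous.aestronglyMeasurable.sub htμ
      have h3 := eLpNorm_le_eLpNorm_mul_rpow_measure_univ (μ := μ) (p := 1) (q := 2)
        (by norm_num) hm
      have h4 : (1 / (1 : ℝ≥0∞).toReal - 1 / (2 : ℝ≥0∞).toReal) = 1 / 2 := by norm_num
      rw [h4] at h3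
      exact h3.trans (by gcongr)
    refine tendsto_of_tendsto_of_tendsto_of_le_of_le tendsto_const_nhds ?_
      (fun _ => bot_le) hle
    have hne : μ Set.univ ^ (1 / 2 : ℝ) ≠ ⊤ :=
      ENNReal.rpow_ne_top_of_nonneg (by norm_num) (measure_ne_top _ _)
    simpa using ENNReal.Tendsto.mul_const hφt (Or.inr hne)
  have hb : ∀ᶠ k in atTop, eLpNorm (partialDeriv j (φ k)) 2 volume ≤ M := by
    filter_upwards [(hφg j).eventually (ge_mem_nhds zero_lt_one)] with k hk
    have : partialDeriv j (φ k) =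
        (fun x => partialDeriv j (φ k) x - U.grad j x) + U.grad j := by ext; simp
    rw [this]
    refine (eLpNorm_add_le ((continuous_partialDeriv (hφ k).1 j).aestronglyMeasurable.sub
      (U.memLp_grad j).1) (U.memLp_grad j).1 (by norm_num)).trans ?_
    rw [add_comm, hM]
    exact add_le_add_right hk _
  have hc : Tendsto (fun k => eLpNorm (fun x => φ k x - ψ x) 2 volume) atTop (𝓝 0) := by
    refine hφU.congr fun k => eLpNorm_congr_ae ?_
    filter_upwards [hψU] with x hx
    rw [hx]
  have hne : ∀ δ : ℝ, (μ Set.univ * ENNReal.ofReal δ) ^ (1 / 2 : ℝ) ≠ ⊤ := fun δ =>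
    ENNReal.rpow_ne_top_of_nonneg (by norm_num)
      (ENNReal.mul_ne_top (measure_ne_top _ _) ENNReal.ofReal_ne_top)
  have h2 : (2 : ℝ≥0∞) ^ (1 / 2 : ℝ) ≠ ⊤ :=
    ENNReal.rpow_ne_top_of_nonneg (by norm_num) (by norm_num)
  -- The order of limits matters. With `δ` fixed, `k → ∞` removes the trace error and the `L²`
  -- error; the gradient term stays bounded by `M` times `δ ^ (1/2)` and disappears as `δ → 0`. The
  -- oscillation `e` of `ψ` goes last.
  have hX1 : ∀ e > 0, ∃ δ₀ > 0, ∀ δ ∈ Set.Ioo 0 δ₀, X ≤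
      (2 : ℝ≥0∞) ^ (1 / 2 : ℝ) * M * (μ Set.univ * ENNReal.ofReal δ) ^ (1 / 2 : ℝ) +
        ENNReal.ofReal e * μ Set.univ := by
    intro e he
    obtain ⟨δ₀, hδ₀, hu⟩ := Metric.uniformContinuous_iff.1 hψ e he
    refine ⟨δ₀, hδ₀, fun δ hδ => ?_⟩
    have hmod : ∀ (y : Plane), ∀ r ∈ Set.Ioo 0 δ, ‖ψ (y + r • basisVec j) - ψ y‖ ≤ e := by
      intro y r hr
      rw [← dist_eq_norm]
      refine (hu ?_).le
      rw [dist_eq_norm, add_sub_cancel_left, norm_smul, Real.norm_of_nonneg hr.1.le]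
      simpa using hr.2.trans hδ.2
    have hδ' : ENNReal.ofReal δ ≠ 0 := by simpa using hδ.1
    have key : ENNReal.ofReal δ * X ≤ ENNReal.ofReal δ * 0 +
        ENNReal.ofReal δ * ((2 : ℝ≥0∞) ^ (1 / 2 : ℝ) * M *
          (μ Set.univ * ENNReal.ofReal δ) ^ (1 / 2 : ℝ)) +
        (2 : ℝ≥0∞) ^ (1 / 2 : ℝ) * 0 * (μ Set.univ * ENNReal.ofReal δ) ^ (1 / 2 : ℝ) +
        ENNReal.ofReal δ * (ENNReal.ofReal e * μ Set.univ) := by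
      refine ge_of_tendsto (((((ENNReal.Tendsto.const_mul ha (Or.inr
        ENNReal.ofReal_ne_top)).add tendsto_const_nhds).add
        (ENNReal.Tendsto.mul_const (ENNReal.Tendsto.const_mul hc (Or.inr h2))
          (Or.inr (hne δ)))).add tendsto_const_nhds)) ?_
      filter_upwards [hb] with k hk
      refine (h.lintegral_sub_le hij (hφ k).1 hψ.continuous htμ hmod).trans ?_
      gcongr
    rw [mul_zero, mul_zero, zero_mul, zero_add, add_zero, ← mul_add] at key
    exact (ENNReal.mul_le_mul_iff_right hδ' ENNReal.ofReal_ne_top).1 key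
  have hX2 : ∀ e > 0, X ≤ ENNReal.ofReal e * μ Set.univ := by
    intro e he
    obtain ⟨δ₀, hδ₀, hb'⟩ := hX1 e he
    have hlim : Tendsto (fun δ : ℝ => (2 : ℝ≥0∞) ^ (1 / 2 : ℝ) * M *
        (μ Set.univ * ENNReal.ofReal δ) ^ (1 / 2 : ℝ) + ENNReal.ofReal e * μ Set.univ)
        (𝓝[>] 0) (𝓝 ((2 : ℝ≥0∞) ^ (1 / 2 : ℝ) * M *
        (μ Set.univ * ENNReal.ofReal 0) ^ (1 / 2 : ℝ) + ENNReal.ofReal e * μ Set.univ)) := by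
      refine Tendsto.add (ENNReal.Tendsto.const_mul ?_ (Or.inr (ENNReal.mul_ne_top h2 hM_ne)))
        tendsto_const_nhds
      refine (ENNReal.continuous_rpow_const.tendsto _).comp ?_
      refine ENNReal.Tendsto.const_mul ?_ (Or.inr (measure_ne_top _ _))
      exact (ENNReal.continuous_ofReal.tendsto 0).mono_left nhdsWithin_le_nhds
    have := ge_of_tendsto hlim (eventually_of_mem (Ioo_mem_nhdsGT hδ₀) hb')
    simpa using this
  have hX0 : X = 0 := by
    have hlim : Tendsto (fun e : ℝ => ENNReal.ofReal e * μ Set.univ) (𝓝[>] 0)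
        (𝓝 (ENNReal.ofReal 0 * μ Set.univ)) :=
      ENNReal.Tendsto.mul_const
        ((ENNReal.continuous_ofReal.tendsto 0).mono_left nhdsWithin_le_nhds)
        (Or.inr (measure_ne_top _ _))
    have := ge_of_tendsto hlim (eventually_of_mem self_mem_nhdsWithin hX2)
    simpa using this
  have hae := (lintegral_eq_zero_iff' (htμ.sub hψ.continuous.aestronglyMeasurable).enorm).1 hX0
  filter_upwards [hae] with y hy
  simpa [sub_eq_zero] using hy

lemma IsTrace.ae_eq_of_uniformContinuous {n : ℕ} (c : Fin n → PlaneCurve) {U : W12}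
    {t : Plane → ℂ} (hU : IsTrace (surfaceMeasure c) U t) {ψ : Plane → ℂ}
    (hψ : UniformContinuous ψ) (hψU : ψ =ᵐ[volume] U.toFun) :
    ∀ᵐ y ∂(surfaceMeasure c), t y = ψ y := by
  refine surfaceMeasure_induction c (Q := fun μ => ∀ᵐ y ∂μ, t y = ψ y) (by simp) ?_ ?_ ?_
  · exact fun μ ν hle h => (Measure.absolutelyContinuous_of_le hle).ae_le h
  · exact fun μ ν h h' => ae_add_measure_iff.2 ⟨h, h'⟩
  · exact fun i μ hfin hle hd => hd.ae_eq_of_isTrace hle hU hψ hψU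

/-! ### The resolvent as a Fourier multiplier and as convolution with the Green function -/

open scoped SchwartzMap FourierTransform RealInnerProductSpace

/-- The symbol of `-Δ + m`. -/
noncomputable def symbol (m : ℝ) (ξ : Plane) : ℝ := m + (2 * Real.pi) ^ 2 * ‖ξ‖ ^ 2

lemma symbol_pos {m : ℝ} (hm : 0 < m) (ξ : Plane) : 0 < symbol m ξ := by
  unfold symbol; positivity

lemma hasTemperateGrowth_symbol (m : ℝ) : (symbol m).HasTemperateGrowth := by
  unfold symbol; fun_prop

lemma hasTemperateGrowth_inv_symbol {m : ℝ} (hm : 0 < m) :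
    (fun ξ => (symbol m ξ)⁻¹).HasTemperateGrowth := by
  -- This scale is chosen so that `symbol m ξ = m (1 + ‖a ξ‖²)`.
  set a : ℝ := 2 * Real.pi / Real.sqrt m with ha
  have h1 : (fun ξ => (symbol m ξ)⁻¹) = fun ξ : Plane =>
      m⁻¹ * ((fun η : Plane => (1 + ‖η‖ ^ 2) ^ (-1 : ℝ)) ∘
        (a • ContinuousLinearMap.id ℝ Plane)) ξ := by
    ext ξ
    have hs : Real.sqrt m ^ 2 = m := Real.sq_sqrt hm.le
    simp only [symbol, Function.comp_apply, Real.rpow_neg_one, ← mul_inv]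
    congr 1
    simp only [_root_.smul_apply, ContinuousLinearMap.id_apply, norm_smul, mul_pow,
      Real.norm_eq_abs, sq_abs, ha, div_pow, hs]
    field_simp
  rw [h1]
  refine (Function.HasTemperateGrowth.const _).mul ?_
  exact (Function.hasTemperateGrowth_one_add_norm_sq_rpow Plane (-1)).comp
    (ContinuousLinearMap.hasTemperateGrowth _)

lemma exp_symbol (m τ : ℝ) (ξ : Plane) :
    Real.exp (-symbol m ξ * τ) =
      Real.exp (-(m * τ)) * Real.exp (-(4 * Real.pi ^ 2 * τ) * ‖ξ‖ ^ 2) := by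
  rw [← Real.exp_add, symbol]; ring_nf

lemma inv_symbol_eq_integral {m : ℝ} (hm : 0 < m) (ξ : Plane) :
    (symbol m ξ)⁻¹ = ∫ τ in Set.Ioi 0, Real.exp (-symbol m ξ * τ) := by
  rw [integral_exp_mul_Ioi (by linarith [symbol_pos hm ξ])]
  simp [neg_div_neg_eq]

/-- The Fourier transform moves from `f` to the other factor under the integral, where the modulated
Gaussian becomes the heat kernel centred at `y`. -/
lemma integral_fourier_mul_gaussian {f : Plane → ℂ} (hf : Integrable f) {τ : ℝ} (hτ : 0 < τ)
    (m : ℝ) (y : Plane) :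
    ∫ ξ, Complex.exp ((2 * Real.pi * ⟪ξ, y⟫ : ℝ) * Complex.I) *
        ((Real.exp (-symbol m ξ * τ) : ℂ) * 𝓕 f ξ) =
      ∫ x, dampedHeat m τ (y - x) • f x := by
  set b : ℝ := 4 * Real.pi ^ 2 * τ with hb
  have hb0 : 0 < b := by positivity
  have hbre : 0 < (b : ℂ).re := by simpa using hb0
  set g : Plane → ℂ := fun ξ =>
    Complex.exp (-(b : ℂ) * ‖ξ‖ ^ 2 + 2 * Real.pi * Complex.I * ⟪y, ξ⟫) with hg
  have hgi : Integrable g :=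
    GaussianFourier.integrable_cexp_neg_mul_sq_norm_add hbre (2 * Real.pi * Complex.I) y
  have hflip := VectorFourier.integral_fourierIntegral_smul_eq_flip (L := innerₗ Plane)
    (μ := volume) (ν := volume) Real.continuous_fourierChar continuous_inner hf hgi
  have hgx : ∀ x, 𝓕 g x = (Real.exp (m * τ) * dampedHeat m τ (y - x) : ℝ) := by
    intro x
    rw [hg, fourier_gaussian_innerProductSpace' hbre y x]
    have h1 : (Real.pi / b : ℂ) ^ (Module.finrank ℝ Plane / 2 : ℂ) =
        ((4 * Real.pi * τ)⁻¹ : ℝ) := by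
      have : (Module.finrank ℝ Plane / 2 : ℂ) = 1 := by simp
      rw [this, Complex.cpow_one, ← Complex.ofReal_div]
      congr 1
      rw [hb]; field_simp
    rw [h1]
    have h2 : (-Real.pi ^ 2 * ‖y - x‖ ^ 2 / b : ℂ) = (-(‖y - x‖ ^ 2 / (4 * τ)) : ℝ) := by
      have hr : -Real.pi ^ 2 * ‖y - x‖ ^ 2 / b = -(‖y - x‖ ^ 2 / (4 * τ)) := by
        rw [hb]; field_simp
      rw [← hr]; push_cast; rfl
    rw [h2, ← Complex.ofReal_exp, ← Complex.ofReal_mul]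
    congr 1
    unfold dampedHeat
    rw [← mul_assoc, ← mul_assoc, ← Real.exp_add, add_neg_cancel, Real.exp_zero, one_mul]
  have hL : ∀ ξ, Complex.exp ((2 * Real.pi * ⟪ξ, y⟫ : ℝ) * Complex.I) *
      ((Real.exp (-symbol m ξ * τ) : ℂ) * 𝓕 f ξ) =
      (Real.exp (-(m * τ)) : ℂ) * (𝓕 f ξ • g ξ) := by
    intro ξ
    have : g ξ = Complex.exp ((2 * Real.pi * ⟪ξ, y⟫ : ℝ) * Complex.I) *
        (Real.exp (-(4 * Real.pi ^ 2 * τ) * ‖ξ‖ ^ 2) : ℂ) := by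
      rw [hg, Complex.ofReal_exp, ← Complex.exp_add, real_inner_comm]
      refine congrArg Complex.exp ?_
      rw [hb]; push_cast; ring
    rw [this, exp_symbol, smul_eq_mul]
    push_cast
    ring
  simp_rw [hL]
  rw [integral_const_mul]
  have hflip' : ∫ ξ, 𝓕 f ξ • g ξ = ∫ x, f x • 𝓕 g x := by
    simpa using! hflip
  rw [hflip', ← integral_const_mul]
  refine integral_congr_ae (ae_of_all _ fun x => ?_)
  simp only [hgx, smul_eq_mul, Complex.real_smul]
  have : Real.exp (-(m * τ)) * Real.exp (m * τ) = 1 := by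
    rw [← Real.exp_add, neg_add_cancel, Real.exp_zero]
  have h' : (Real.exp (-(m * τ)) : ℂ) * (Real.exp (m * τ) : ℂ) = 1 := by
    rw [← Complex.ofReal_mul, this, Complex.ofReal_one]
  push_cast at h' ⊢
  linear_combination (f x * (dampedHeat m τ (y - x) : ℂ)) * h'

lemma integral_integral_dampedHeat {f : Plane → ℂ} (hf : AEStronglyMeasurable f volume) {B : ℝ}
    (hB : ∀ x, ‖f x‖ ≤ B) {m : ℝ} (hm : 0 < m) (y : Plane) :
    ∫ τ in Set.Ioi 0, (∫ x, dampedHeat m τ (y - x) • f x) = ∫ x, green m (y - x) • f x := by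
  have hmeas : AEStronglyMeasurable (fun p : ℝ × Plane => dampedHeat m p.1 (y - p.2) • f p.2)
      ((volume.restrict (Set.Ioi 0)).prod volume) := by
    have hd : AEStronglyMeasurable (fun p : ℝ × Plane => dampedHeat m p.1 (y - p.2))
        ((volume.restrict (Set.Ioi 0)).prod volume) :=
      ((measurable_dampedHeat m).comp
        (measurable_fst.prodMk (measurable_const.sub measurable_snd))).aestronglyMeasurable
    exact hd.smul hf.comp_snd
  have hbd : ∀ τ ∈ Set.Ioi (0 : ℝ), ∀ x, ‖dampedHeat m τ (y - x) • f x‖ ≤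
      dampedHeat m τ (y - x) * B := by
    intro τ hτ x
    rw [norm_smul, Real.norm_of_nonneg (dampedHeat_nonneg m hτ _)]
    exact mul_le_mul_of_nonneg_left (hB x) (dampedHeat_nonneg m hτ _)
  have hint : ∀ τ ∈ Set.Ioi (0 : ℝ), Integrable fun x => dampedHeat m τ (y - x) • f x := by
    intro τ hτ
    refine Integrable.mono' ((integrable_dampedHeat m hτ y).mul_const B) ?_
      (ae_of_all _ (hbd τ hτ))
    exact ((measurable_dampedHeat m).comp (measurable_const.prodMk
      (measurable_const.sub measurable_id))).aestronglyMeasurable.smul hf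
  rw [integral_integral_swap (f := fun τ x => dampedHeat m τ (y - x) • f x)]
  · refine integral_congr_ae (ae_of_all _ fun x => ?_)
    exact integral_smul_const _ _
  · rw [Function.uncurry_def, integrable_prod_iff hmeas]
    refine ⟨(ae_restrict_iff' measurableSet_Ioi).2 (ae_of_all _ hint), ?_⟩
    refine Integrable.mono' ((integrableOn_exp_mul_Ioi (by linarith : -m < 0) 0).mul_const B)
      hmeas.norm.integral_prod_right' ?_
    refine (ae_restrict_iff' measurableSet_Ioi).2 (ae_of_all _ fun τ hτ => ?_)
    rw [Real.norm_of_nonneg (by positivity)]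
    calc _ ≤ ∫ x, dampedHeat m τ (y - x) * B :=
          integral_mono (hint τ hτ).norm ((integrable_dampedHeat m hτ y).mul_const B) (hbd τ hτ)
      _ = _ := by rw [integral_mul_const, integral_dampedHeat m hτ]; ring_nf

/-- The resolvent of the Laplacian on Schwartz functions. -/
noncomputable def resolvent (m : ℝ) (f : 𝓢(Plane, ℂ)) : 𝓢(Plane, ℂ) :=
  SchwartzMap.fourierMultiplierCLM ℂ (fun ξ => (symbol m ξ)⁻¹) f

/-- Writing `1 / symbol` as the integral of `exp (-symbol τ)` over `τ > 0` makes the resolvent the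
time integral of the heat semigroup, and the Green function is by definition the time integral of
its kernels. -/
lemma resolvent_apply {m : ℝ} (hm : 0 < m) (f : 𝓢(Plane, ℂ)) (y : Plane) :
    resolvent m f y = ∫ x, green m (y - x) • f x := by
  obtain ⟨B, hB⟩ : ∃ B : ℝ, ∀ x, ‖f x‖ ≤ B :=
    ⟨‖f.toBoundedContinuousFunction‖, f.toBoundedContinuousFunction.norm_coe_le_norm⟩
  rw [← integral_integral_dampedHeat f.continuous.aestronglyMeasurable hB hm y, resolvent,
    SchwartzMap.fourierMultiplierCLM_apply, SchwartzMap.fourierInv_coe, Real.fourierInv_eq']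
  have h1 : ∀ ξ, Complex.exp ((2 * Real.pi * ⟪ξ, y⟫ : ℝ) * Complex.I) •
      (SchwartzMap.smulLeftCLM ℂ (fun ξ => (symbol m ξ)⁻¹) (𝓕 f)) ξ =
      ∫ τ in Set.Ioi 0, Complex.exp ((2 * Real.pi * ⟪ξ, y⟫ : ℝ) * Complex.I) *
        ((Real.exp (-symbol m ξ * τ) : ℂ) * 𝓕 (f : Plane → ℂ) ξ) := by
    intro ξ
    rw [integral_const_mul, integral_mul_const, integral_complex_ofReal,
      ← inv_symbol_eq_integral hm,
      SchwartzMap.smulLeftCLM_apply_apply (hasTemperateGrowth_inv_symbol hm), Complex.real_smul,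
      smul_eq_mul, SchwartzMap.fourier_coe]
  simp_rw [h1]
  rw [integral_integral_swap]
  · refine setIntegral_congr_fun measurableSet_Ioi fun τ hτ => ?_
    exact integral_fourier_mul_gaussian f.integrable hτ m y
  · have hF : Integrable (𝓕 (f : Plane → ℂ)) := (𝓕 f).integrable
    have hFc : Continuous (𝓕 (f : Plane → ℂ)) := (𝓕 f).continuous
    have hdom := hF.norm.mul_prod
      (integrableOn_exp_mul_Ioi (by linarith : -m < 0) 0)
    refine Integrable.mono' hdom ?_ ?_
    · refine Continuous.aestronglyMeasurable ?_
      unfold symbol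
      simp only [Function.uncurry_def]
      fun_prop
    · have hτ : ∀ᵐ p : Plane × ℝ ∂(volume.prod (volume.restrict (Set.Ioi 0))), 0 < p.2 :=
        Measure.quasiMeasurePreserving_snd.ae
          ((ae_restrict_iff' measurableSet_Ioi).2 (ae_of_all _ fun τ hτ => hτ))
      filter_upwards [hτ] with p hp
      simp only [Function.uncurry_def, norm_mul, Complex.norm_exp_ofReal_mul_I, one_mul,
        Complex.norm_real, Real.norm_eq_abs, Real.abs_exp]
      rw [mul_comm]
      gcongr
      unfold symbol
      have : 0 ≤ (2 * Real.pi) ^ 2 * ‖p.1‖ ^ 2 := by positivity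
      linarith

/-- The Laplacian, as the sum of the iterated partial derivatives. -/
noncomputable def lap {F : Type*} [NormedAddCommGroup F] [NormedSpace ℝ F] (f : Plane → F)
    (x : Plane) : F :=
  ∑ i, partialDeriv i (partialDeriv i f) x

open LineDeriv in
lemma lap_schwartz (φ : 𝓢(Plane, ℂ)) (x : Plane) : lap φ x = Laplacian.laplacian φ x := by
  rw [SchwartzMap.laplacian_eq_sum (EuclideanSpace.basisFun (Fin 2) ℝ), _root_.sum_apply]
  refine Finset.sum_congr rfl fun i _ => ?_
  rw [EuclideanSpace.basisFun_apply]
  rfl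

lemma resolvent_equation {m : ℝ} (hm : 0 < m) (f : 𝓢(Plane, ℂ)) (x : Plane) :
    m * resolvent m f x - lap (resolvent m f) x = f x := by
  have h1 : SchwartzMap.fourierMultiplierCLM ℂ (symbol m) (resolvent m f) = f := by
    rw [resolvent, SchwartzMap.fourierMultiplierCLM_fourierMultiplierCLM_apply
      (hasTemperateGrowth_symbol m) (hasTemperateGrowth_inv_symbol hm)]
    have : (symbol m * fun ξ => (symbol m ξ)⁻¹) = fun _ => (1 : ℝ) := by
      ext ξ
      exact mul_inv_cancel₀ (symbol_pos hm ξ).ne'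
    rw [this, SchwartzMap.fourierMultiplierCLM_const]
    simp
  have h2 : SchwartzMap.fourierMultiplierCLM ℂ (symbol m) (resolvent m f) =
      m • resolvent m f - Laplacian.laplacian (resolvent m f) := by
    have hsq : (fun ξ : Plane => ‖ξ‖ ^ 2).HasTemperateGrowth :=
      Function.hasTemperateGrowth_norm_sq Plane
    rw [SchwartzMap.laplacian_eq_fourierMultiplierCLM]
    simp only [SchwartzMap.fourierMultiplierCLM_apply]
    have hadd : SchwartzMap.smulLeftCLM ℂ (symbol m) (𝓕 (resolvent m f)) =
        m • 𝓕 (resolvent m f) +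
          (2 * Real.pi) ^ 2 • SchwartzMap.smulLeftCLM ℂ (fun ξ : Plane => ‖ξ‖ ^ 2)
            (𝓕 (resolvent m f)) := by
      ext ξ
      rw [SchwartzMap.smulLeftCLM_apply_apply (hasTemperateGrowth_symbol m),
        _root_.add_apply, _root_.smul_apply, _root_.smul_apply,
        SchwartzMap.smulLeftCLM_apply_apply hsq, symbol, add_smul, mul_smul]
    rw [hadd]
    rw [FourierTransform.fourierInv_add, FourierTransform.fourierInv_smul,
      FourierTransform.fourierInv_smul, FourierTransform.fourierInv_fourier_eq, neg_smul,
      sub_neg_eq_add]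
  rw [lap_schwartz]
  have h3 := congrArg (fun g : 𝓢(Plane, ℂ) => g x) (h2.symm.trans h1)
  simpa using h3

/-! ### Calculus of partial derivatives and cutoffs -/

section PartialDeriv

lemma contDiff_partialDeriv {F : Type*} [NormedAddCommGroup F] [NormedSpace ℝ F] {f : Plane → F}
    (hf : ContDiff ℝ ∞ f) (i : Fin 2) : ContDiff ℝ ∞ (partialDeriv i f) :=
  (hf.fderiv_right (by simp)).clm_apply contDiff_const

lemma hasCompactSupport_partialDeriv {F : Type*} [NormedAddCommGroup F] [NormedSpace ℝ F]
    {f : Plane → F} (hf : HasCompactSupport f) (i : Fin 2) :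
    HasCompactSupport (partialDeriv i f) :=
  hf.fderiv_apply ℝ _

lemma partialDeriv_mul {f g : Plane → ℂ} (hf : Differentiable ℝ f) (hg : Differentiable ℝ g)
    (i : Fin 2) : partialDeriv i (fun x => f x * g x) =
      fun x => f x * partialDeriv i g x + partialDeriv i f x * g x := by
  ext x
  simp only [partialDeriv]
  rw [fderiv_fun_mul (hf x) (hg x)]
  simp [mul_comm]

lemma partialDeriv_add {f g : Plane → ℂ} (hf : Differentiable ℝ f) (hg : Differentiable ℝ g)
    (i : Fin 2) : partialDeriv i (fun x => f x + g x) =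
      fun x => partialDeriv i f x + partialDeriv i g x := by
  ext x
  simp only [partialDeriv]
  rw [fderiv_fun_add (hf x) (hg x)]
  rfl

lemma partialDeriv_conj (f : Plane → ℂ) (i : Fin 2) :
    partialDeriv i (fun x => (starRingEnd ℂ) (f x)) =
      fun x => (starRingEnd ℂ) (partialDeriv i f x) := by
  ext x
  have h := Complex.conjCLE.comp_fderiv (f := f) (x := x)
  have h' : (fun x => (starRingEnd ℂ) (f x)) = Complex.conjCLE ∘ f := rfl
  simp only [partialDeriv]
  rw [h', h]
  rfl

lemma partialDeriv_comp_smul (f : Plane → ℂ) (a : ℝ) (i : Fin 2) :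
    partialDeriv i (fun x => f (a • x)) = fun x => (a : ℂ) * partialDeriv i f (a • x) := by
  ext x
  simp only [partialDeriv]
  rw [fderiv_comp_smul]
  simp

lemma contDiff_lap {F : Type*} [NormedAddCommGroup F] [NormedSpace ℝ F] {f : Plane → F}
    (hf : ContDiff ℝ ∞ f) : ContDiff ℝ ∞ (lap f) := by
  unfold lap
  exact ContDiff.sum fun i _ => contDiff_partialDeriv (contDiff_partialDeriv hf i) i

lemma hasCompactSupport_lap {F : Type*} [NormedAddCommGroup F] [NormedSpace ℝ F]
    {f : Plane → F} (hf : HasCompactSupport f) : HasCompactSupport (lap f) := by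
  have h : ∀ i, HasCompactSupport (partialDeriv i (partialDeriv i f)) := fun i =>
    hasCompactSupport_partialDeriv (hasCompactSupport_partialDeriv hf i) i
  have : lap f = fun x => partialDeriv 0 (partialDeriv 0 f) x +
      partialDeriv 1 (partialDeriv 1 f) x := by
    ext x; simp [lap]
  rw [this]
  exact (h 0).add (h 1)

/-- The product rule for the Laplacian of a function cut off at a large scale. -/
lemma lap_cutoff_mul {χ φ : Plane → ℂ} (hχ : ContDiff ℝ ∞ χ) (hφ : ContDiff ℝ ∞ φ) (a : ℝ)
    (x : Plane) : lap (fun x => χ (a • x) * φ x) x = χ (a • x) * lap φ x +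
      (2 * (a : ℂ) * (∑ i, partialDeriv i χ (a • x) * partialDeriv i φ x) +
        (a : ℂ) ^ 2 * (lap χ (a • x) * φ x)) := by
  have hne : (∞ : WithTop ℕ∞) ≠ 0 := by simp
  have hχa : ContDiff ℝ ∞ fun x : Plane => χ (a • x) := hχ.comp (contDiff_const_smul a)
  have hi : ∀ i, partialDeriv i (partialDeriv i (fun x => χ (a • x) * φ x)) x =
      χ (a • x) * partialDeriv i (partialDeriv i φ) x +
      (2 * (a : ℂ) * (partialDeriv i χ (a • x) * partialDeriv i φ x) +
      (a : ℂ) ^ 2 * (partialDeriv i (partialDeriv i χ) (a • x) * φ x)) := by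
    intro i
    have hd : Differentiable ℝ (partialDeriv i fun x => χ (a • x)) :=
      (contDiff_partialDeriv hχa i).differentiable hne
    have hdφ : Differentiable ℝ (partialDeriv i φ) :=
      (contDiff_partialDeriv hφ i).differentiable hne
    have h2 : partialDeriv i (partialDeriv i fun x => χ (a • x)) x =
        (a : ℂ) ^ 2 * partialDeriv i (partialDeriv i χ) (a • x) := by
      rw [partialDeriv_comp_smul]
      have hd2 : Differentiable ℝ fun x : Plane => partialDeriv i χ (a • x) :=
        ((contDiff_partialDeriv hχ i).comp (contDiff_const_smul a)).differentiable hne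
      rw [partialDeriv_mul (f := fun _ => (a : ℂ)) (differentiable_const _) hd2,
        partialDeriv_comp_smul]
      simp only [partialDeriv, fderiv_const_apply]
      simp only [_root_.zero_apply, zero_mul, add_zero]
      ring
    rw [partialDeriv_mul (hχa.differentiable hne) (hφ.differentiable hne),
      partialDeriv_add (f := fun x => χ (a • x) * partialDeriv i φ x)
        (g := fun x => partialDeriv i (fun x => χ (a • x)) x * φ x)
        ((hχa.differentiable hne).mul hdφ) (hd.mul (hφ.differentiable hne)),
      partialDeriv_mul (hχa.differentiable hne) hdφ,
      partialDeriv_mul hd (hφ.differentiable hne)]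
    simp only [h2]
    simp only [partialDeriv_comp_smul]
    ring
  simp only [lap, hi, Fin.sum_univ_two]
  ring

end PartialDeriv

/-! ### From the form equation to the integral equation -/

/-- A smooth function of compact support as an element of `W^{1,2}`. -/
noncomputable def W12.ofTest (ζ : Plane → ℂ) (hζ : ContDiff ℝ ∞ ζ) (hc : HasCompactSupport ζ) :
    W12 where
  toFun := ζ
  grad := fun i => partialDeriv i ζ
  memLp := hζ.continuous.memLp_of_hasCompactSupport hc
  memLp_grad := fun i => (contDiff_partialDeriv hζ i).continuous.memLp_of_hasCompactSupport
    (hasCompactSupport_partialDeriv hc i)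
  hasWeakPartialDeriv := by
    intro i φ hφ hφc
    have hne : (∞ : WithTop ℕ∞) ≠ 0 := by simp
    refine integral_mul_fderiv_eq_neg_fderiv_mul_of_integrable ?_ ?_ ?_
      (fun x _ => hζ.differentiable hne x) (fun x _ => hφ.differentiable hne x)
    · exact ((contDiff_partialDeriv hζ i).continuous.mul hφ.continuous).integrable_of_hasCompactSupport
        hφc.mul_left
    · exact (hζ.continuous.mul (contDiff_partialDeriv hφ i).continuous).integrable_of_hasCompactSupport
        hc.mul_right
    · exact (hζ.continuous.mul hφ.continuous).integrable_of_hasCompactSupport hc.mul_right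

lemma isTrace_ofTest (σ : Measure Plane) [IsFiniteMeasure σ] {ζ : Plane → ℂ}
    (hζ : ContDiff ℝ ∞ ζ) (hc : HasCompactSupport ζ) : IsTrace σ (W12.ofTest ζ hζ hc) ζ := by
  refine ⟨hζ.continuous.memLp_of_hasCompactSupport hc, fun _ => ζ, fun _ => ⟨hζ, hc⟩, ?_, ?_, ?_⟩
  · simp [W12.ofTest]
  · simp [W12.ofTest]
  · simp

/-- The distributional form of the eigenvalue equation. -/
lemma weak_equation {α : ℝ} {σ : Measure Plane} [IsFiniteMeasure σ] {E : ℝ} {U : W12}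
    {t : Plane → ℂ} (hU : ∀ (v : W12) (tv : Plane → ℂ), IsTrace σ v tv →
      energyForm α σ U t v tv = ∫ x, ((E : ℂ) * U.toFun x) * (starRingEnd ℂ) (v.toFun x))
    {ζ : Plane → ℂ} (hζ : ContDiff ℝ ∞ ζ) (hc : HasCompactSupport ζ) :
    (∫ x, U.toFun x * lap ζ x) + α * ∫ x, t x * ζ x ∂σ + E * ∫ x, U.toFun x * ζ x = 0 := by
  -- Testing with the conjugate of `ζ` removes the conjugations from the sesquilinear form.
  have hζ' : ContDiff ℝ ∞ fun x => (starRingEnd ℂ) (ζ x) := Complex.conjCLE.contDiff.comp hζ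
  have hc' : HasCompactSupport fun x => (starRingEnd ℂ) (ζ x) :=
    hc.comp_left (g := starRingEnd ℂ) (map_zero _)
  have h := hU (W12.ofTest _ hζ' hc') _ (isTrace_ofTest σ hζ' hc')
  simp only [energyForm, W12.ofTest, partialDeriv_conj, Complex.conj_conj] at h
  have hw : ∀ i, ∫ x, U.toFun x * partialDeriv i (partialDeriv i ζ) x =
      - ∫ x, U.grad i x * partialDeriv i ζ x := fun i =>
    U.hasWeakPartialDeriv i _ (contDiff_partialDeriv hζ i) (hasCompactSupport_partialDeriv hc i)
  have hd : ∀ i, MemLp (partialDeriv i ζ) 2 volume := fun i =>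
    (contDiff_partialDeriv hζ i).continuous.memLp_of_hasCompactSupport
      (hasCompactSupport_partialDeriv hc i)
  have hdd : ∀ i, MemLp (partialDeriv i (partialDeriv i ζ)) 2 volume := fun i =>
    (contDiff_partialDeriv (contDiff_partialDeriv hζ i) i).continuous.memLp_of_hasCompactSupport
      (hasCompactSupport_partialDeriv (hasCompactSupport_partialDeriv hc i) i)
  have h1 : ∫ x, U.toFun x * lap ζ x = - ∫ x, ∑ i, U.grad i x * partialDeriv i ζ x := by
    simp only [lap, Finset.mul_sum]
    have hi1 : ∀ i, Integrable fun x => U.toFun x * partialDeriv i (partialDeriv i ζ) x :=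
      fun i => U.memLp.integrable_mul (hdd i)
    have hi2 : ∀ i, Integrable fun x => U.grad i x * partialDeriv i ζ x :=
      fun i => (U.memLp_grad i).integrable_mul (hd i)
    rw [integral_finsetSum _ fun i _ => hi1 i, integral_finsetSum _ fun i _ => hi2 i,
      ← Finset.sum_neg_distrib]
    exact Finset.sum_congr rfl fun i _ => hw i
  have h2 : ∫ x, (E : ℂ) * U.toFun x * ζ x = E * ∫ x, U.toFun x * ζ x := by
    rw [← integral_const_mul]
    simp_rw [mul_assoc]
  rw [h2] at h
  rw [h1, ← h]
  ring

lemma exists_bound_of_compactSupport {f : Plane → ℂ} (hf : Continuous f)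
    (hc : HasCompactSupport f) : ∃ C : ℝ, 0 ≤ C ∧ ∀ x, ‖f x‖ ≤ C := by
  obtain ⟨C, hC⟩ := hf.bounded_above_of_compact_support hc
  exact ⟨C, (norm_nonneg _).trans (hC 0), hC⟩

/-- A cutoff function. -/
lemma exists_cutoff : ∃ χ : Plane → ℂ, ContDiff ℝ ∞ χ ∧ HasCompactSupport χ ∧
    (∀ x, ‖χ x‖ ≤ 1) ∧ χ 0 = 1 := by
  let b : ContDiffBump (0 : Plane) := ⟨1, 2, one_pos, one_lt_two⟩
  refine ⟨fun x => (b x : ℂ), Complex.ofRealCLM.contDiff.comp b.contDiff,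
    b.hasCompactSupport.comp_left (g := Complex.ofReal) Complex.ofReal_zero, fun x => ?_, ?_⟩
  · rw [Complex.norm_real, Real.norm_of_nonneg b.nonneg]
    exact b.le_one
  · have : b 0 = 1 := b.one_of_mem_closedBall (by simp [b])
    simp [this]

/-- The distributional equation tested with a Schwartz function. -/
lemma weak_equation_schwartz {α : ℝ} {σ : Measure Plane} [IsFiniteMeasure σ] {E : ℝ}
    {u t : Plane → ℂ} (hu : MemLp u 2 volume) (ht : Integrable t σ)
    (h : ∀ ζ : Plane → ℂ, ContDiff ℝ ∞ ζ → HasCompactSupport ζ →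
      (∫ x, u x * lap ζ x) + α * ∫ x, t x * ζ x ∂σ + E * ∫ x, u x * ζ x = 0)
    (φ : 𝓢(Plane, ℂ)) :
    (∫ x, u x * lap φ x) + α * ∫ x, t x * φ x ∂σ + E * ∫ x, u x * φ x = 0 := by
  obtain ⟨χ, hχ, hχc, hχ1, hχ0⟩ := exists_cutoff
  have hφ : ContDiff ℝ ∞ (φ : Plane → ℂ) := φ.smooth ⊤
  set a : ℕ → ℝ := fun k => 1 / ((k : ℝ) + 1) with ha
  have ha0 : ∀ k, 0 < a k := fun k => by positivity
  have ha1 : ∀ k, a k ≤ 1 := fun k => by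
    rw [ha]
    simp only
    rw [div_le_one (by positivity)]
    linarith [(Nat.cast_nonneg k : (0 : ℝ) ≤ k)]
  have halim : Tendsto a atTop (𝓝 0) := tendsto_one_div_add_atTop_nhds_zero_nat
  -- The cutoff spreads to the whole plane as `a k → 0`. Terms in which a derivative falls on it
  -- carry a factor `a k`, and `a k ≤ 1` provides a majorant independent of `k`.
  set ζ : ℕ → Plane → ℂ := fun k x => χ (a k • x) * φ x with hζ
  have hζs : ∀ k, ContDiff ℝ ∞ (ζ k) := fun k => (hχ.comp (contDiff_const_smul (a k))).mul hφ
  have hζc : ∀ k, HasCompactSupport (ζ k) := fun k =>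
    (hχc.comp_smul (ha0 k).ne').mul_right
  have hs : ∀ x : Plane, Tendsto (fun k => a k • x) atTop (𝓝 0) := fun x => by
    simpa using halim.smul_const x
  have hχlim : ∀ x : Plane, Tendsto (fun k => χ (a k • x)) atTop (𝓝 1) := fun x => by
    rw [← hχ0]
    exact (hχ.continuous.tendsto 0).comp (hs x)
  have hζlim : ∀ x, Tendsto (fun k => ζ k x) atTop (𝓝 (φ x)) := fun x => by
    simpa using (hχlim x).mul_const (φ x)
  have hζle : ∀ k x, ‖ζ k x‖ ≤ ‖φ x‖ := fun k x => by
    rw [hζ]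
    simp only [norm_mul]
    exact mul_le_of_le_one_left (norm_nonneg _) (hχ1 _)
  obtain ⟨C₀, hC₀, hχ'⟩ : ∃ C : ℝ, 0 ≤ C ∧ ∀ i x, ‖partialDeriv i χ x‖ ≤ C := by
    choose C hC hb using fun i => exists_bound_of_compactSupport
      (contDiff_partialDeriv hχ i).continuous (hasCompactSupport_partialDeriv hχc i)
    refine ⟨∑ i, C i, Finset.sum_nonneg fun i _ => hC i, fun i x => (hb i x).trans ?_⟩
    exact Finset.single_le_sum (fun i _ => hC i) (Finset.mem_univ i)
  obtain ⟨C₁, hC₁, hχ''⟩ := exists_bound_of_compactSupport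
    (contDiff_lap hχ).continuous (hasCompactSupport_lap hχc)
  have hφL : MemLp (φ : Plane → ℂ) 2 volume := φ.memLp 2 volume
  have hdL : ∀ i, MemLp (partialDeriv i φ) 2 volume := fun i =>
    (LineDeriv.lineDerivOp (basisVec i) φ : 𝓢(Plane, ℂ)).memLp 2 volume
  have hlL : MemLp (lap φ) 2 volume := by
    have : lap φ = (Laplacian.laplacian φ : 𝓢(Plane, ℂ)) := funext (lap_schwartz φ)
    rw [this]
    exact (Laplacian.laplacian φ : 𝓢(Plane, ℂ)).memLp 2 volume
  set D : Plane → ℝ := fun x => ‖lap φ x‖ + (2 * (∑ i, C₀ * ‖partialDeriv i φ x‖) + C₁ * ‖φ x‖)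
    with hD
  have hDle : ∀ k x, ‖lap (ζ k) x‖ ≤ D x := by
    intro k x
    rw [hζ, lap_cutoff_mul hχ hφ, hD]
    have ea : ‖(a k : ℂ)‖ ≤ 1 := by
      rw [Complex.norm_real, Real.norm_of_nonneg (ha0 k).le]
      exact ha1 k
    refine (norm_add_le _ _).trans (add_le_add ?_ ((norm_add_le _ _).trans (add_le_add ?_ ?_)))
    · rw [norm_mul]
      exact mul_le_of_le_one_left (norm_nonneg _) (hχ1 _)
    · rw [norm_mul, norm_mul, Complex.norm_ofNat]
      have hsum : ‖∑ i, partialDeriv i χ (a k • x) * partialDeriv i φ x‖ ≤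
          ∑ i, C₀ * ‖partialDeriv i φ x‖ := by
        refine norm_sum_le_of_le _ fun i _ => ?_
        rw [norm_mul]
        exact mul_le_mul_of_nonneg_right (hχ' i _) (norm_nonneg _)
      calc _ ≤ 2 * 1 * ∑ i, C₀ * ‖partialDeriv i φ x‖ := by gcongr
        _ = _ := by ring
    · rw [norm_mul, norm_mul, norm_pow]
      calc _ ≤ 1 ^ 2 * (C₁ * ‖φ x‖) := by gcongr; exact hχ'' _
        _ = _ := by ring
  have hDL : Integrable fun x => ‖u x‖ * D x := by
    have h1 : Integrable fun x => ‖u x‖ * ‖lap φ x‖ := hu.norm.integrable_mul hlL.norm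
    have h2 : ∀ i, Integrable fun x => ‖u x‖ * ‖partialDeriv i φ x‖ := fun i =>
      hu.norm.integrable_mul (hdL i).norm
    have h3 : Integrable fun x => ‖u x‖ * ‖φ x‖ := hu.norm.integrable_mul hφL.norm
    refine ((h1.add (((h2 0).add (h2 1)).const_mul (2 * C₀))).add (h3.const_mul C₁)).congr
      (ae_of_all _ fun x => ?_)
    simp only [hD, Fin.sum_univ_two, Pi.add_apply]
    ring
  have hlim1 : Tendsto (fun k => ∫ x, u x * lap (ζ k) x) atTop (𝓝 (∫ x, u x * lap φ x)) := by
    refine tendsto_integral_of_dominated_convergence _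
      (fun k => hu.1.mul (contDiff_lap (hζs k)).continuous.aestronglyMeasurable) hDL
      (fun k => ae_of_all _ fun x => ?_) (ae_of_all _ fun x => ?_)
    · rw [norm_mul]
      exact mul_le_mul_of_nonneg_left (hDle k x) (norm_nonneg _)
    · refine Tendsto.const_mul _ ?_
      have hac : Tendsto (fun k => (a k : ℂ)) atTop (𝓝 0) := by
        rw [← Complex.ofReal_zero]
        exact (Complex.continuous_ofReal.tendsto 0).comp halim
      have hp : ∀ i, Tendsto (fun k => partialDeriv i χ (a k • x)) atTop
          (𝓝 (partialDeriv i χ 0)) := fun i =>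
        ((contDiff_partialDeriv hχ i).continuous.tendsto 0).comp (hs x)
      have hl : Tendsto (fun k => lap χ (a k • x)) atTop (𝓝 (lap χ 0)) :=
        ((contDiff_lap hχ).continuous.tendsto 0).comp (hs x)
      have := ((hχlim x).mul_const (lap φ x)).add
        (((hac.const_mul 2).mul (tendsto_finsetSum Finset.univ fun i _ =>
          (hp i).mul_const (partialDeriv i φ x))).add ((hac.pow 2).mul (hl.mul_const (φ x))))
      simp only [mul_zero, zero_mul, add_zero, one_mul, ne_eq, OfNat.ofNat_ne_zero,
        not_false_eq_true, zero_pow] at this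
      refine this.congr fun k => ?_
      rw [hζ, lap_cutoff_mul hχ hφ]
  have hlim2 : Tendsto (fun k => ∫ x, u x * ζ k x) atTop (𝓝 (∫ x, u x * φ x)) := by
    refine tendsto_integral_of_dominated_convergence (fun x => ‖u x‖ * ‖φ x‖)
      (fun k => hu.1.mul (hζs k).continuous.aestronglyMeasurable)
      (hu.norm.integrable_mul hφL.norm) (fun k => ae_of_all _ fun x => ?_)
      (ae_of_all _ fun x => (hζlim x).const_mul _)
    rw [norm_mul]
    exact mul_le_mul_of_nonneg_left (hζle k x) (norm_nonneg _)
  have hlim3 : Tendsto (fun k => ∫ x, t x * ζ k x ∂σ) atTop (𝓝 (∫ x, t x * φ x ∂σ)) := by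
    set B := ‖φ.toBoundedContinuousFunction‖
    have hB : ∀ x, ‖φ x‖ ≤ B := φ.toBoundedContinuousFunction.norm_coe_le_norm
    refine tendsto_integral_of_dominated_convergence (fun x => ‖t x‖ * B)
      (fun k => ht.1.mul (hζs k).continuous.aestronglyMeasurable)
      (ht.norm.mul_const B) (fun k => ae_of_all _ fun x => ?_)
      (ae_of_all _ fun x => (hζlim x).const_mul _)
    rw [norm_mul]
    exact mul_le_mul_of_nonneg_left ((hζle k x).trans (hB x)) (norm_nonneg _)
  have hlim := (hlim1.add (hlim3.const_mul (α : ℂ))).add (hlim2.const_mul (E : ℂ))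
  refine tendsto_nhds_unique (hlim.congr fun k => ?_) tendsto_const_nhds
  exact h (ζ k) (hζs k) (hζc k)

/-- A solution of the distributional equation is the single layer potential of its trace. -/
lemma ae_eq_potential {α : ℝ} {σ : Measure Plane} [IsFiniteMeasure σ] (hσ : IsDiffuse σ) {E : ℝ}
    (hE : E < 0) {u t : Plane → ℂ} (hu : MemLp u 2 volume) (ht : MemLp t 2 σ)
    (h : ∀ ζ : Plane → ℂ, ContDiff ℝ ∞ ζ → HasCompactSupport ζ →
      (∫ x, u x * lap ζ x) + α * ∫ x, t x * ζ x ∂σ + E * ∫ x, u x * ζ x = 0) :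
    ∀ᵐ x, u x = (α : ℂ) * potential (-E) σ t x := by
  have hm : 0 < -E := by linarith
  have ht1 : Integrable t σ := ht.integrable (by norm_num)
  have hpc : Continuous (potential (-E) σ t) := hσ.continuous_potential hm ht
  refine ae_eq_of_integral_contDiff_smul_eq (hu.locallyIntegrable (by norm_num))
    (continuous_const.mul hpc).locallyIntegrable fun g hg hgc => ?_
  have hgs : ContDiff ℝ ∞ fun x => (g x : ℂ) := Complex.ofRealCLM.contDiff.comp hg
  have hgsc : HasCompactSupport fun x => (g x : ℂ) :=
    hgc.comp_left (g := Complex.ofReal) Complex.ofReal_zero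
  set f : 𝓢(Plane, ℂ) := hgsc.toSchwartzMap hgs with hf
  have hfx : ∀ x, f x = g x := fun x => rfl
  -- Duality: testing with the solution of `(-Δ - E) φ = f` leaves `∫ f u = α ∫ t φ dσ`, and the
  -- kernel of the resolvent then passes to `t` by Fubini and symmetry. Since `φ` is only known to
  -- be Schwartz, the extension of the weak equation beyond compact supports is needed.
  set φ := resolvent (-E) f with hφ
  have hw := weak_equation_schwartz hu ht1 h φ
  have hφL : MemLp (φ : Plane → ℂ) 2 volume := φ.memLp 2 volume
  have hlL : MemLp (lap φ) 2 volume := by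
    have : lap φ = (Laplacian.laplacian φ : 𝓢(Plane, ℂ)) := funext (lap_schwartz φ)
    rw [this]
    exact (Laplacian.laplacian φ : 𝓢(Plane, ℂ)).memLp 2 volume
  have hi1 : Integrable fun x => -(u x * lap φ x) := (hu.integrable_mul hlL).neg
  have hi2 : Integrable fun x => u x * φ x := hu.integrable_mul hφL
  have h1 : ∫ x, g x • u x = -(∫ x, u x * lap φ x) - E * ∫ x, u x * φ x := by
    rw [← integral_const_mul, ← integral_neg, ← integral_sub hi1 (hi2.const_mul _)]
    refine integral_congr_ae (ae_of_all _ fun x => ?_)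
    have := resolvent_equation hm f x
    simp only [Complex.real_smul, ← hfx, ← this, ← hφ]
    push_cast
    ring
  have h2 : ∫ x, g x • u x = α * ∫ y, t y * φ y ∂σ := by
    rw [h1]; linear_combination -hw
  rw [h2]
  have hprod := hσ.integrable_prod_green hm ht (ν := volume) f.integrable
  have h3 : ∫ y, t y * φ y ∂σ = ∫ x, f x * potential (-E) σ t x := by
    have hy : ∀ y, t y * φ y = ∫ x, f x * (green (-E) (x - y) • t y) := by
      intro y
      rw [hφ, resolvent_apply hm, ← integral_const_mul]
      refine integral_congr_ae (ae_of_all _ fun x => ?_)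
      simp only [green_sub_comm (-E) y x, Complex.real_smul]
      ring
    have hx : ∀ x, f x * potential (-E) σ t x = ∫ y, f x * (green (-E) (x - y) • t y) ∂σ := by
      intro x
      rw [potential, integral_const_mul]
    simp_rw [hy, hx]
    exact (integral_integral_swap hprod).symm
  rw [h3, ← integral_const_mul]
  refine integral_congr_ae (ae_of_all _ fun x => ?_)
  simp only [hfx, Complex.real_smul]
  ring

/-! ### The maximum principle for distributional solutions -/

/-- A positive second derivative would make the point a local minimum as well, hence `g` locally
constant, hence its second derivative `0`. -/
lemma deriv_deriv_nonpos_of_isLocalMax {g : ℝ → ℝ} {s : ℝ} (hg : IsLocalMax g s)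
    (hc : ContinuousAt g s) : deriv (deriv g) s ≤ 0 := by
  by_contra! h
  have hmin := isLocalMin_of_deriv_deriv_pos h hg.deriv_eq_zero hc
  have hconst : g =ᶠ[𝓝 s] fun _ => g s := by
    filter_upwards [hg, hmin] with x h1 h2
    exact le_antisymm h1 h2
  have h' : deriv g =ᶠ[𝓝 s] fun _ => 0 := by
    filter_upwards [hconst.deriv] with x hx
    rw [hx, deriv_const]
  rw [h'.deriv_eq, deriv_const] at h
  exact lt_irrefl _ h

lemma deriv_comp_line {f : Plane → ℝ} (hf : Differentiable ℝ f) (x : Plane) (i : Fin 2) :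
    deriv (fun s : ℝ => f (x + s • basisVec i)) =
      fun s => partialDeriv i f (x + s • basisVec i) := by
  ext s
  have h2 : HasDerivAt (fun ρ : ℝ => x + ρ • basisVec i) (basisVec i) s := by
    simpa using ((hasDerivAt_id s).smul_const (basisVec i)).const_add x
  exact ((hf _).hasFDerivAt.comp_hasDerivAt s h2).deriv

lemma lap_nonpos_of_isLocalMax {f : Plane → ℝ} (hf : ContDiff ℝ ∞ f) {x : Plane}
    (hx : IsLocalMax f x) : lap f x ≤ 0 := by
  have hne : (∞ : WithTop ℕ∞) ≠ 0 := by simp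
  refine Finset.sum_nonpos fun i _ => ?_
  have hc : Continuous fun s : ℝ => x + s • basisVec i := by fun_prop
  have hmax : IsLocalMax (fun s : ℝ => f (x + s • basisVec i)) 0 := by
    have h0 : Tendsto (fun s : ℝ => x + s • basisVec i) (𝓝 0) (𝓝 x) := by
      simpa using hc.tendsto 0
    have := h0.eventually hx
    filter_upwards [this] with s hs
    simpa using hs
  have h := deriv_deriv_nonpos_of_isLocalMax hmax (hf.continuous.comp hc).continuousAt
  rw [deriv_comp_line (hf.differentiable hne),
    deriv_comp_line ((contDiff_partialDeriv hf i).differentiable hne)] at h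
  simpa using h

lemma partialDeriv_comp_sub {f : Plane → ℝ} (hf : Differentiable ℝ f) (x : Plane) (i : Fin 2) :
    partialDeriv i (fun y => f (x - y)) = fun y => -partialDeriv i f (x - y) := by
  ext y
  have h1 : HasFDerivAt (fun y : Plane => x - y) (-ContinuousLinearMap.id ℝ Plane) y :=
    (hasFDerivAt_id y).const_sub x
  have h2 : fderiv ℝ (fun y => f (x - y)) y = _ :=
    ((hf (x - y)).hasFDerivAt.comp y h1).fderiv
  rw [partialDeriv, h2]
  simp [partialDeriv]

lemma lap_comp_sub {f : Plane → ℝ} (hf : ContDiff ℝ ∞ f) (x y : Plane) :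
    lap (fun y => f (x - y)) y = lap f (x - y) := by
  refine Finset.sum_congr rfl fun i _ => ?_
  have h : partialDeriv i (fun y => -partialDeriv i f (x - y)) y =
      -partialDeriv i (fun y => partialDeriv i f (x - y)) y := by
    simp only [partialDeriv]
    rw [fderiv_fun_neg]
    rfl
  rw [partialDeriv_comp_sub (hf.differentiable (by simp)), h,
    partialDeriv_comp_sub ((contDiff_partialDeriv hf i).differentiable (by simp)), neg_neg]

/-- The mollification of `ψ` with the kernel `ρ`. -/
noncomputable def mollify (ψ ρ : Plane → ℝ) (x : Plane) : ℝ := ∫ y, ψ y * ρ (x - y)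

lemma contDiff_mollify {ψ ρ : Plane → ℝ} (hψ : Continuous ψ) (hρ : ContDiff ℝ ∞ ρ)
    (hc : HasCompactSupport ρ) : ContDiff ℝ ∞ (mollify ψ ρ) :=
  hc.contDiff_convolution_right (ContinuousLinearMap.mul ℝ ℝ) hψ.locallyIntegrable hρ

lemma partialDeriv_mollify {ψ ρ : Plane → ℝ} (hψ : Continuous ψ) (hρ : ContDiff ℝ ∞ ρ)
    (hc : HasCompactSupport ρ) (i : Fin 2) :
    partialDeriv i (mollify ψ ρ) = mollify ψ (partialDeriv i ρ) := by
  ext x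
  have h := hc.hasFDerivAt_convolution_right (ContinuousLinearMap.mul ℝ ℝ)
    hψ.locallyIntegrable (hρ.of_le (by simp)) x (μ := volume)
  have h' : fderiv ℝ (mollify ψ ρ) x = _ := h.fderiv
  rw [partialDeriv, h', convolution_precompR_apply (ContinuousLinearMap.mul ℝ ℝ)
    hψ.locallyIntegrable (hc.fderiv ℝ) (hρ.continuous_fderiv (by simp))]
  rfl

lemma lap_mollify {ψ ρ : Plane → ℝ} (hψ : Continuous ψ) (hρ : ContDiff ℝ ∞ ρ)
    (hc : HasCompactSupport ρ) (x : Plane) :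
    lap (mollify ψ ρ) x = ∫ y, ψ y * lap (fun y => ρ (x - y)) y := by
  have h : ∀ i, partialDeriv i (partialDeriv i (mollify ψ ρ)) x =
      ∫ y, ψ y * partialDeriv i (partialDeriv i ρ) (x - y) := by
    intro i
    rw [partialDeriv_mollify hψ hρ hc, partialDeriv_mollify hψ (contDiff_partialDeriv hρ i)
      (hasCompactSupport_partialDeriv hc i)]
    rfl
  have hi : ∀ i, Integrable fun y => ψ y * partialDeriv i (partialDeriv i ρ) (x - y) := by
    intro i
    have hcc : HasCompactSupport fun y => partialDeriv i (partialDeriv i ρ) (x - y) :=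
      (hasCompactSupport_partialDeriv (hasCompactSupport_partialDeriv hc i) i).comp_homeomorph
        (Homeomorph.subLeft x)
    refine (hψ.mul ?_).integrable_of_hasCompactSupport hcc.mul_left
    exact (contDiff_partialDeriv (contDiff_partialDeriv hρ i) i).continuous.comp
      (continuous_const.sub continuous_id)
  simp only [lap_comp_sub hρ]
  simp only [lap, h, Finset.mul_sum]
  rw [integral_finsetSum _ fun i _ => hi i]

lemma exists_mollifier {ψ : Plane → ℝ} (hψ : UniformContinuous ψ) {η r : ℝ} (hη : 0 < η)
    (hr : 0 < r) : ∃ ρ : Plane → ℝ, ContDiff ℝ ∞ ρ ∧ HasCompactSupport ρ ∧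
      tsupport ρ ⊆ Metric.closedBall 0 r ∧ ∀ x, |mollify ψ ρ x - ψ x| ≤ η := by
  obtain ⟨δ, hδ, hu⟩ := Metric.uniformContinuous_iff.1 hψ η hη
  have hmin : 0 < min δ r := lt_min hδ hr
  let b : ContDiffBump (0 : Plane) := ⟨min δ r / 2, min δ r, by linarith, by linarith⟩
  refine ⟨b.normed volume, b.contDiff_normed, b.hasCompactSupport_normed, ?_, fun x => ?_⟩
  · rw [b.tsupport_normed_eq]
    exact Metric.closedBall_subset_closedBall (min_le_right _ _)
  · have h := ContDiffBump.dist_normed_convolution_le (μ := volume) (φ := b) (g := ψ) (x₀ := x)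
      (ε := η) hψ.continuous.aestronglyMeasurable
      fun y hy => (hu ((Metric.mem_ball.1 hy).trans_le (min_le_left _ _))).le
    rw [Real.dist_eq] at h
    have he : mollify ψ (b.normed volume) x =
        convolution (b.normed volume) ψ (ContinuousLinearMap.lsmul ℝ ℝ) volume x := by
      rw [mollify, convolution, ← integral_sub_left_eq_self _ volume x]
      refine integral_congr_ae (ae_of_all _ fun y => ?_)
      simp [mul_comm]
    rw [he]
    exact h

lemma lap_sub_norm_sq {f : Plane → ℝ} (hf : ContDiff ℝ ∞ f) (δ : ℝ) (x₀ x : Plane) :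
    lap (fun x => f x - δ * ‖x - x₀‖ ^ 2) x = lap f x - 4 * δ := by
  have hne : (∞ : WithTop ℕ∞) ≠ 0 := by simp
  have h1 : ∀ i, partialDeriv i (fun x => f x - δ * ‖x - x₀‖ ^ 2) =
      fun x => partialDeriv i f x - 2 * δ * (x i - x₀ i) := by
    intro i
    ext y
    have hd : HasFDerivAt (fun x : Plane => δ * ‖x - x₀‖ ^ 2)
        (δ • (2 • (innerSL ℝ (y - x₀)))) y := by
      have := ((hasFDerivAt_id y).sub_const x₀).norm_sq
      simpa using! this.const_mul δ
    have := ((hf.differentiable hne y).hasFDerivAt.sub hd).fderiv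
    simp only [partialDeriv]
    have h' : fderiv ℝ (fun x => f x - δ * ‖x - x₀‖ ^ 2) y = _ := this
    rw [h']
    simp [EuclideanSpace.inner_single_right]
    ring
  have h2 : ∀ i, partialDeriv i (fun x => partialDeriv i f x - 2 * δ * (x i - x₀ i)) x =
      partialDeriv i (partialDeriv i f) x - 2 * δ := by
    intro i
    have hd : HasFDerivAt (fun x : Plane => 2 * δ * (x i - x₀ i))
        ((2 * δ) • (EuclideanSpace.proj (𝕜 := ℝ) i : Plane →L[ℝ] ℝ)) x :=
      (((EuclideanSpace.proj (𝕜 := ℝ) i : Plane →L[ℝ] ℝ).hasFDerivAt).sub_const _).const_mul _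
    have := (((contDiff_partialDeriv hf i).differentiable hne x).hasFDerivAt.sub hd).fderiv
    have h' : fderiv ℝ (fun x => partialDeriv i f x - 2 * δ * (x i - x₀ i)) x = _ := this
    rw [partialDeriv, h']
    simp [partialDeriv]
  simp only [lap, h1, h2, Fin.sum_univ_two]
  ring

/-- A distributional solution of `Δψ = mψ` outside `Γ` has no positive local maximum there. -/
lemma mem_of_isLocalMax_of_pos {Γ : Set Plane} (hΓ : IsClosed Γ) {m : ℝ} (hm : 0 < m)
    {ψ : Plane → ℝ} (hψ : UniformContinuous ψ)
    (heq : ∀ ζ : Plane → ℝ, ContDiff ℝ ∞ ζ → HasCompactSupport ζ → tsupport ζ ⊆ Γᶜ →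
      ∫ x, ψ x * lap ζ x = m * ∫ x, ψ x * ζ x)
    {x₀ : Plane} (hx₀ : IsLocalMax ψ x₀) (hpos : 0 < ψ x₀) : x₀ ∈ Γ := by
  by_contra hmem
  have hc : 0 < ψ x₀ / 2 := by linarith
  have hev : ∀ᶠ x in 𝓝 x₀, x ∈ Γᶜ ∧ ψ x ≤ ψ x₀ ∧ ψ x₀ / 2 < ψ x :=
    (show ∀ᶠ x in 𝓝 x₀, x ∈ Γᶜ from hΓ.isOpen_compl.mem_nhds hmem).and (hx₀.and
      (hψ.continuous.continuousAt.eventually (lt_mem_nhds (by linarith))))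
  obtain ⟨R, hR, hball⟩ := Metric.eventually_nhds_iff_ball.1 hev
  -- Mollification at scale `r` of points within `r` of `x₀` sees only points within `2 r < R`.
  set r := R / 3 with hr
  have hr0 : 0 < r := by positivity
  have hsub : ∀ x ∈ Metric.closedBall x₀ r, x ∈ Metric.ball x₀ R := fun x hx =>
    Metric.mem_ball.2 ((Metric.mem_closedBall.1 hx).trans_lt (by rw [hr]; linarith))
  -- Regularity of `ψ` and strictness of the maximum are both unavailable, so `ψ` is mollified
  -- within `η` and `δ ‖x - x₀‖²` is subtracted. Since `2 η < δ r²`, the maximum on the closed ball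
  -- is interior. There the mollification is at least `ψ x₀ / 4`, so the Laplacian is at least `m ψ
  -- x₀ / 4 - 4 δ = m ψ x₀ / 8 > 0`, which is impossible.
  set δ := m * ψ x₀ / 32 with hδ
  have hδ0 : 0 < δ := by positivity
  set η := min (ψ x₀ / 4) (δ * r ^ 2 / 4) with hη
  have hη0 : 0 < η := lt_min (by linarith) (by positivity)
  have hη1 : η ≤ ψ x₀ / 4 := min_le_left _ _
  have hη2 : η ≤ δ * r ^ 2 / 4 := min_le_right _ _
  have hδr : 0 < δ * r ^ 2 := by positivity
  obtain ⟨ρ, hρ, hρc, hρs, hρψ⟩ := exists_mollifier hψ hη0 hr0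
  set Ψ := mollify ψ ρ with hΨ
  have hΨs : ContDiff ℝ ∞ Ψ := contDiff_mollify hψ.continuous hρ hρc
  set f : Plane → ℝ := fun x => Ψ x - δ * ‖x - x₀‖ ^ 2 with hf
  have hfs : ContDiff ℝ ∞ f := hΨs.sub (contDiff_const.mul
    ((contDiff_id.sub contDiff_const).norm_sq ℝ))
  obtain ⟨x₁, hx₁, hmax⟩ := (isCompact_closedBall x₀ r).exists_isMaxOn
    ⟨x₀, Metric.mem_closedBall_self hr0.le⟩ hfs.continuous.continuousOn
  have hcenter : f x₀ ≤ f x₁ := hmax (Metric.mem_closedBall_self hr0.le)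
  have hf₀ : f x₀ = Ψ x₀ := by simp [hf]
  have hΨ₀ := (abs_le.1 (hρψ x₀)).1
  have hΨ₁ := abs_le.1 (hρψ x₁)
  obtain ⟨-, hle₁, hge₁⟩ := hball x₁ (hsub x₁ hx₁)
  have hint : x₁ ∈ Metric.ball x₀ r := by
    rw [mem_ball_iff_norm]
    by_contra! hge
    have h1 : δ * r ^ 2 ≤ δ * ‖x₁ - x₀‖ ^ 2 := by gcongr
    have h2 : f x₁ = Ψ x₁ - δ * ‖x₁ - x₀‖ ^ 2 := rfl
    linarith [hΨ₁.2]
  have hlocal : IsLocalMax f x₁ :=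
    hmax.isLocalMax (Filter.mem_of_superset (Metric.isOpen_ball.mem_nhds hint)
      Metric.ball_subset_closedBall)
  have hlap := lap_nonpos_of_isLocalMax hfs hlocal
  rw [hf, lap_sub_norm_sq hΨs, hΨ, lap_mollify hψ.continuous hρ hρc,
    heq (fun y => ρ (x₁ - y)) (hρ.comp (contDiff_const.sub contDiff_id))
      (hρc.comp_homeomorph (Homeomorph.subLeft x₁)) ?_] at hlap
  · have h3 : m * (ψ x₀ / 4) ≤ m * Ψ x₁ := by
      gcongr
      linarith [hΨ₁.1]
    have h5 : 4 * δ = m * ψ x₀ / 8 := by rw [hδ]; ring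
    have h6 : 0 < m * ψ x₀ := by positivity
    have h7 : m * ∫ x, ψ x * ρ (x₁ - x) = m * Ψ x₁ := rfl
    linarith
  · intro y hy
    have hy' : x₁ - y ∈ tsupport ρ :=
      tsupport_comp_subset_preimage ρ (continuous_const.sub continuous_id) hy
    have hy2 := hρs hy'
    rw [mem_closedBall_zero_iff] at hy2
    refine (hball y ?_).1
    rw [mem_ball_iff_norm]
    calc ‖y - x₀‖ = ‖(x₁ - x₀) - (x₁ - y)‖ := by congr 1; abel
      _ ≤ ‖x₁ - x₀‖ + ‖x₁ - y‖ := norm_sub_le _ _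
      _ ≤ r + r := add_le_add (mem_closedBall_iff_norm.1 hx₁) hy2
      _ < R := by rw [hr]; linarith

/-! ### Bound states: continuous representative and location of maxima -/

lemma potential_congr {F : Type*} [NormedAddCommGroup F] [NormedSpace ℝ F] {σ : Measure Plane}
    {t t' : Plane → F} (h : t =ᵐ[σ] t') (m : ℝ) : potential m σ t = potential m σ t' := by
  ext x
  refine integral_congr_ae ?_
  filter_upwards [h] with y hy
  rw [hy]

/-- A negative-energy eigenfunction has a continuous representative, which vanishes at infinity
and is the single layer potential of its own restriction to the curve. -/
lemma exists_representative {n : ℕ} (c : Fin n → PlaneCurve) {α E : ℝ} (hE : E < 0)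
    {u : Plane → ℂ} (hu : IsEigenfunction α (surfaceMeasure c) E u) :
    ∃ ψ : Plane → ℂ, Continuous ψ ∧ Tendsto ψ (cocompact Plane) (𝓝 0) ∧ ψ =ᵐ[volume] u ∧
      MemLp ψ 2 (surfaceMeasure c) ∧
      (∀ x, ψ x = (α : ℂ) * potential (-E) (surfaceMeasure c) ψ x) ∧
      ¬ (ψ =ᵐ[surfaceMeasure c] 0) ∧
      ∀ ζ : Plane → ℂ, ContDiff ℝ ∞ ζ → HasCompactSupport ζ →
        (∫ x, ψ x * lap ζ x) + α * ∫ x, ψ x * ζ x ∂(surfaceMeasure c) + E * ∫ x, ψ x * ζ x = 0 := by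
  set σ := surfaceMeasure c
  obtain ⟨⟨-, U, t, hUu, hUt, hU⟩, hne⟩ := hu
  have hσ : IsDiffuse σ := isDiffuse_surfaceMeasure c
  have hm : 0 < -E := by linarith
  have ht : MemLp t 2 σ := hUt.1
  subst hUu
  have hweak : ∀ ζ : Plane → ℂ, ContDiff ℝ ∞ ζ → HasCompactSupport ζ →
      (∫ x, U.toFun x * lap ζ x) + α * ∫ x, t x * ζ x ∂σ + E * ∫ x, U.toFun x * ζ x = 0 :=
    fun ζ hζ hc => weak_equation hU hζ hc
  have hrep := ae_eq_potential hσ hE U.memLp ht hweak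
  set ψ : Plane → ℂ := fun x => (α : ℂ) * potential (-E) σ t x with hψ
  have hψc : Continuous ψ := continuous_const.mul (hσ.continuous_potential hm ht)
  have hψ0 : Tendsto ψ (cocompact Plane) (𝓝 0) := by
    simpa [hψ] using (hσ.tendsto_potential_cocompact (isCompact_support c)
      (surfaceMeasure_compl_support c) hm ht).const_mul (α : ℂ)
  have hψU : ψ =ᵐ[volume] U.toFun := by
    filter_upwards [hrep] with x hx
    exact hx.symm
  -- A continuous function vanishing at infinity is uniformly continuous, so its restriction is the
  -- trace; this closes the integral equation on `Γ`.
  have htψ : t =ᵐ[σ] ψ := hUt.ae_eq_of_uniformContinuous c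
    (hψc.uniformContinuous_of_tendsto_cocompact hψ0) hψU
  have hself : ∀ x, ψ x = (α : ℂ) * potential (-E) σ ψ x := fun x => by
    rw [← potential_congr htψ]
  refine ⟨ψ, hψc, hψ0, hψU, (memLp_congr_ae htψ).1 ht, hself, fun h0 => hne ?_,
    fun ζ hζ hc => ?_⟩
  · refine hψU.symm.trans (ae_of_all _ fun x => ?_)
    rw [hself x, potential_congr h0]
    simp [potential]
  · rw [← hweak ζ hζ hc]
    have h1 : ∀ f : Plane → ℂ, ∫ x, ψ x * f x = ∫ x, U.toFun x * f x := fun f =>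
      integral_congr_ae (by filter_upwards [hψU] with x hx; rw [hx])
    have h2 : ∫ x, ψ x * ζ x ∂σ = ∫ x, t x * ζ x ∂σ :=
      integral_congr_ae (by filter_upwards [htψ] with x hx; rw [hx])
    rw [h1, h1, h2]

/-- A nontrivial real-valued continuous solution of the eigenvalue equation at energy `-m`,
in integral form and in distributional form away from `Γ`. -/
structure IsBoundState (α m : ℝ) (σ : Measure Plane) (Γ : Set Plane) (ψ : Plane → ℝ) : Prop where
  continuous : Continuous ψ
  tendsto_zero : Tendsto ψ (cocompact Plane) (𝓝 0)
  memLp : MemLp ψ 2 σ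
  eq_potential : ∀ x, ψ x = α * potential m σ ψ x
  nontrivial : ¬ (ψ =ᵐ[σ] 0)
  lap_eq : ∀ ζ : Plane → ℝ, ContDiff ℝ ∞ ζ → HasCompactSupport ζ → tsupport ζ ⊆ Γᶜ →
    ∫ x, ψ x * lap ζ x = m * ∫ x, ψ x * ζ x

lemma IsBoundState.neg {α m : ℝ} {σ : Measure Plane} {Γ : Set Plane} {ψ : Plane → ℝ}
    (h : IsBoundState α m σ Γ ψ) : IsBoundState α m σ Γ (fun x => -ψ x) where
  continuous := h.continuous.neg
  tendsto_zero := by simpa using h.tendsto_zero.neg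
  memLp := h.memLp.neg
  eq_potential := fun x => by
    have h1 : potential m σ (fun x => -ψ x) x = -potential m σ ψ x := by
      simp [potential, integral_neg]
    rw [h1, h.eq_potential x]
    ring
  nontrivial := fun h0 => h.nontrivial (by
    filter_upwards [h0] with x hx
    simpa using hx)
  lap_eq := fun ζ hζ hc hs => by
    have := h.lap_eq ζ hζ hc hs
    simp only [neg_mul, integral_neg, this, mul_neg]

/-- The Green function is positive off the diagonal, so a zero of the potential at a single point
would force the density to vanish almost everywhere on `Γ`. -/
lemma IsBoundState.pos_of_nonneg {α m : ℝ} {σ : Measure Plane} {Γ : Set Plane} {ψ : Plane → ℝ}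
    (h : IsBoundState α m σ Γ ψ) (hσ : IsDiffuse σ) (hα : 0 < α) (hm : 0 < m)
    (h0 : ∀ᵐ y ∂σ, 0 ≤ ψ y) (x : Plane) : 0 < ψ x := by
  have hnn : 0 ≤ᵐ[σ] fun y => green m (x - y) • ψ y := by
    filter_upwards [h0] with y hy
    exact mul_nonneg (green_nonneg _ _) hy
  have hint := hσ.integrable_green_smul hm h.memLp x
  have hpos : 0 ≤ potential m σ ψ x := integral_nonneg_of_ae hnn
  rw [h.eq_potential x]
  refine mul_pos hα (hpos.lt_of_ne' fun hz => h.nontrivial ?_)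
  have hae := (integral_eq_zero_iff_of_nonneg_ae hnn hint).1 hz
  filter_upwards [hae, hσ.ae_ne x] with y hy hxy
  exact (mul_eq_zero.1 hy).resolve_left (green_pos hm hxy).ne'

/-- Decay at infinity makes a maximum value nonnegative. Were it not positive, `-ψ` would be
nonnegative and nontrivial on `Γ`, so strictly positive everywhere, and the maximum would be
negative. -/
lemma IsBoundState.pos_of_isMax {α m : ℝ} {σ : Measure Plane} {Γ : Set Plane} {ψ : Plane → ℝ}
    (h : IsBoundState α m σ Γ ψ) (hσ : IsDiffuse σ) (hα : 0 < α) (hm : 0 < m) {x : Plane}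
    (hx : ∀ y, ψ y ≤ ψ x) : 0 < ψ x := by
  by_contra! hle
  have hneg := h.neg.pos_of_nonneg hσ hα hm
    (ae_of_all _ fun y => neg_nonneg.2 ((hx y).trans hle)) x
  have hge : 0 ≤ ψ x := le_of_tendsto h.tendsto_zero (Eventually.of_forall hx)
  linarith

lemma IsBoundState.mem_of_isLocalMax {α m : ℝ} {σ : Measure Plane} {Γ : Set Plane}
    {ψ : Plane → ℝ} (h : IsBoundState α m σ Γ ψ) (hΓ : IsClosed Γ) (hm : 0 < m) {x : Plane}
    (hx : IsLocalMax ψ x) (hpos : 0 < ψ x) : x ∈ Γ :=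
  mem_of_isLocalMax_of_pos hΓ hm
    (h.continuous.uniformContinuous_of_tendsto_cocompact h.tendsto_zero) h.lap_eq hx hpos

lemma IsBoundState.mem_of_isMax {α m : ℝ} {σ : Measure Plane} {Γ : Set Plane} {ψ : Plane → ℝ}
    (h : IsBoundState α m σ Γ ψ) (hσ : IsDiffuse σ) (hα : 0 < α) (hΓ : IsClosed Γ) (hm : 0 < m)
    {x : Plane} (hx : ∀ y, ψ y ≤ ψ x) : x ∈ Γ :=
  h.mem_of_isLocalMax hΓ hm (Eventually.of_forall hx) (h.pos_of_isMax hσ hα hm hx)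

lemma IsBoundState.exists_isMax {α m : ℝ} {σ : Measure Plane} {Γ : Set Plane} {ψ : Plane → ℝ}
    (h : IsBoundState α m σ Γ ψ) (hσ : IsDiffuse σ) (hα : 0 < α) (hΓ : IsClosed Γ) (hm : 0 < m)
    (hpos : ∃ y, 0 < ψ y) : ∃ x ∈ Γ, ∀ y, ψ y ≤ ψ x := by
  obtain ⟨y₀, hy₀⟩ := hpos
  obtain ⟨x, hx⟩ := h.continuous.exists_forall_ge' y₀
    ((h.tendsto_zero.eventually (gt_mem_nhds hy₀)).mono fun x hx => hx.le)
  exact ⟨x, h.mem_of_isMax hσ hα hΓ hm hx, hx⟩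

/-! ### Comparison of energies and ground states -/

/-- A bound state that is positive on the curve has the largest binding energy. -/
lemma IsBoundState.ae_eq_zero_of_lt {α m m' : ℝ} {σ : Measure Plane} [IsFiniteMeasure σ]
    {Γ : Set Plane} {ψ : Plane → ℝ} (h : IsBoundState α m σ Γ ψ) (hσ : IsDiffuse σ) (hα : 0 < α)
    (hm : 0 < m) (hmm : m < m') (hpos : ∀ᵐ y ∂σ, 0 < ψ y) {φ : Plane → ℂ} (hφ : MemLp φ 2 σ)
    (hφeq : ∀ x, φ x = (α : ℂ) * potential m' σ φ x) : φ =ᵐ[σ] 0 := by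
  have hm' : 0 < m' := hm.trans hmm
  set g : Plane → ℝ := fun x => ‖φ x‖ with hg
  have hgL : MemLp g 2 σ := hφ.norm
  -- By positivity of the kernel, the modulus of a solution is a subsolution.
  have hgle : ∀ x, g x ≤ α * potential m' σ g x := by
    intro x
    rw [hg]
    simp only
    rw [hφeq x, norm_mul, Complex.norm_real, Real.norm_of_nonneg hα.le]
    refine mul_le_mul_of_nonneg_left ((norm_integral_le_integral_norm _).trans_eq ?_) hα.le
    refine integral_congr_ae (ae_of_all _ fun y => ?_)
    simp only [norm_smul, Real.norm_of_nonneg (green_nonneg _ _), smul_eq_mul]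
  have hprod : Integrable (fun p : Plane × Plane => ψ p.1 * (green m' (p.1 - p.2) • g p.2))
      (σ.prod σ) := hσ.integrable_prod_green hm' hgL (h.memLp.integrable (by norm_num))
  have hleft : ∀ x, ∫ y, ψ x * (green m' (x - y) • g y) ∂σ = ψ x * potential m' σ g x :=
    fun x => integral_const_mul _ _
  have hright : ∀ y, ∫ x, ψ x * (green m' (x - y) • g y) ∂σ = g y * potential m' σ ψ y := by
    intro y
    rw [potential, ← integral_const_mul]
    refine integral_congr_ae (ae_of_all _ fun x => ?_)
    simp only [smul_eq_mul, green_sub_comm m' y x]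
    ring
  have hi1 : Integrable (fun x => ψ x * potential m' σ g x) σ :=
    hprod.integral_prod_left.congr (ae_of_all _ hleft)
  have hi2 : Integrable (fun y => g y * potential m' σ ψ y) σ :=
    hprod.integral_prod_right.congr (ae_of_all _ hright)
  have hi3 : Integrable (fun x => g x * ψ x) σ := hgL.integrable_mul h.memLp
  have hswap : ∫ x, ψ x * potential m' σ g x ∂σ = ∫ y, g y * potential m' σ ψ y ∂σ := by
    simp_rw [← hleft, ← hright]
    exact integral_integral_swap hprod
  -- Strict monotonicity of the Green function in `m` makes the positive `ψ` a strict supersolution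
  -- at the larger value `m'`.
  have hd : ∀ y, 0 < ψ y - α * potential m' σ ψ y := by
    intro y
    have hI := hσ.integrable_green_smul hm h.memLp y
    have hI' := hσ.integrable_green_smul hm' h.memLp y
    have hlt : ∀ᵐ z ∂σ, 0 < green m (y - z) • ψ z - green m' (y - z) • ψ z := by
      filter_upwards [hpos, hσ.ae_ne y] with z hz hyz
      rw [← sub_smul]
      exact mul_pos (sub_pos.2 (green_strictAnti hm hmm hyz)) hz
    have hnn : 0 ≤ᵐ[σ] fun z => green m (y - z) • ψ z - green m' (y - z) • ψ z :=
      hlt.mono fun z hz => hz.le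
    have hdiff : potential m σ ψ y - potential m' σ ψ y =
        ∫ z, (green m (y - z) • ψ z - green m' (y - z) • ψ z) ∂σ := (integral_sub hI hI').symm
    have hge : 0 ≤ potential m σ ψ y - potential m' σ ψ y := by
      rw [hdiff]; exact integral_nonneg_of_ae hnn
    have hne : potential m σ ψ y - potential m' σ ψ y ≠ 0 := by
      intro hz
      rw [hdiff] at hz
      have hae := (integral_eq_zero_iff_of_nonneg_ae hnn (hI.sub hI')).1 hz
      refine h.nontrivial ?_
      filter_upwards [hae, hlt] with z h1 h2
      exact absurd h1 h2.ne'
    rw [h.eq_potential y, ← mul_sub]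
    exact mul_pos hα (lt_of_le_of_ne hge hne.symm)
  -- Pairing the subsolution `g` with `ψ` and moving the symmetric kernel onto `ψ` gives the
  -- opposite sign, so the nonnegative integrand vanishes.
  have hle : ∫ y, g y * (ψ y - α * potential m' σ ψ y) ∂σ ≤ 0 := by
    have h1 : ∫ x, g x * ψ x ∂σ ≤ ∫ x, α * (ψ x * potential m' σ g x) ∂σ := by
      refine integral_mono_ae hi3 (hi1.const_mul α) ?_
      filter_upwards [hpos] with x hx
      calc g x * ψ x ≤ α * potential m' σ g x * ψ x :=
            mul_le_mul_of_nonneg_right (hgle x) hx.le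
        _ = _ := by ring
    have h2 : ∫ y, g y * (ψ y - α * potential m' σ ψ y) ∂σ =
        ∫ x, g x * ψ x ∂σ - ∫ y, α * (g y * potential m' σ ψ y) ∂σ := by
      rw [← integral_sub hi3 (hi2.const_mul α)]
      refine integral_congr_ae (ae_of_all _ fun y => ?_)
      simp only
      ring
    rw [h2]
    rw [integral_const_mul] at h1 ⊢
    rw [← hswap]
    linarith
  have hnn : 0 ≤ᵐ[σ] fun y => g y * (ψ y - α * potential m' σ ψ y) :=
    ae_of_all _ fun y => mul_nonneg (norm_nonneg _) (hd y).le
  have hint : Integrable (fun y => g y * (ψ y - α * potential m' σ ψ y)) σ := by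
    refine (hi3.sub (hi2.const_mul α)).congr (ae_of_all _ fun y => ?_)
    simp only [Pi.sub_apply]
    ring
  have hae := (integral_eq_zero_iff_of_nonneg_ae hnn hint).1
    (le_antisymm hle (integral_nonneg_of_ae hnn))
  filter_upwards [hae] with y hy
  exact norm_eq_zero.1 ((mul_eq_zero.1 hy).resolve_right (hd y).ne')

lemma partialDeriv_ofReal {f : Plane → ℝ} (hf : Differentiable ℝ f) (i : Fin 2) :
    partialDeriv i (fun x => (f x : ℂ)) = fun x => ((partialDeriv i f x : ℝ) : ℂ) := by
  ext x
  have h : fderiv ℝ (fun x => (f x : ℂ)) x = _ :=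
    (Complex.ofRealCLM.hasFDerivAt.comp x (hf x).hasFDerivAt).fderiv
  rw [partialDeriv, h]
  rfl

lemma lap_ofReal {f : Plane → ℝ} (hf : ContDiff ℝ ∞ f) (x : Plane) :
    lap (fun x => (f x : ℂ)) x = ((lap f x : ℝ) : ℂ) := by
  have hne : (∞ : WithTop ℕ∞) ≠ 0 := by simp
  simp only [lap, Complex.ofReal_sum, partialDeriv_ofReal (hf.differentiable hne),
    partialDeriv_ofReal ((contDiff_partialDeriv hf _).differentiable hne)]

/-- The imaginary part of the representative is continuous and vanishes almost everywhere, hence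
everywhere. For test functions supported off `Γ` the curve term drops out of the weak equation. -/
lemma exists_isBoundState {n : ℕ} (c : Fin n → PlaneCurve) {α E : ℝ} (hE : E < 0)
    {u : Plane → ℝ} (hu : IsEigenfunction α (surfaceMeasure c) E (fun x => (u x : ℂ))) :
    ∃ ψ : Plane → ℝ, ψ =ᵐ[volume] u ∧
      IsBoundState α (-E) (surfaceMeasure c) (support c) ψ := by
  obtain ⟨φ, hφc, hφ0, hφu, hφL, hφeq, hφne, hφw⟩ := exists_representative c hE hu
  set ψ : Plane → ℝ := fun x => (φ x).re with hψ
  have him : (fun x => (φ x).im) = fun _ => (0 : ℝ) := by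
    refine (Continuous.ae_eq_iff_eq volume (Complex.continuous_im.comp hφc)
      continuous_const).1 ?_
    filter_upwards [hφu] with x hx
    simp [hx]
  have hφψ : ∀ x, φ x = (ψ x : ℂ) := fun x =>
    Complex.ext (by simp [hψ]) (by simpa using congrFun him x)
  refine ⟨ψ, ?_, Complex.continuous_re.comp hφc, ?_, hφL.re, fun x => ?_, fun h0 => hφne ?_,
    fun ζ hζ hc hs => ?_⟩
  · filter_upwards [hφu] with x hx
    simp [hψ, hx]
  · simpa using! (Complex.continuous_re.tendsto 0).comp hφ0
  · have h1 : potential (-E) (surfaceMeasure c) φ x =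
        ((potential (-E) (surfaceMeasure c) ψ x : ℝ) : ℂ) := by
      rw [potential, potential, ← integral_complex_ofReal]
      refine integral_congr_ae (ae_of_all _ fun y => ?_)
      simp [hφψ]
    have h2 := hφeq x
    rw [h1, hφψ] at h2
    exact_mod_cast h2
  · filter_upwards [h0] with x hx
    rw [hφψ, hx]
    simp
  · have hζ' : ContDiff ℝ ∞ fun x => (ζ x : ℂ) := Complex.ofRealCLM.contDiff.comp hζ
    have hc' : HasCompactSupport fun x => (ζ x : ℂ) :=
      hc.comp_left (g := Complex.ofReal) Complex.ofReal_zero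
    have hw := hφw _ hζ' hc'
    have h0 : ∫ x, φ x * (ζ x : ℂ) ∂(surfaceMeasure c) = 0 := by
      refine integral_eq_zero_of_ae ?_
      have hsup : ∀ᵐ x ∂(surfaceMeasure c), x ∈ support c := surfaceMeasure_compl_support c
      filter_upwards [hsup] with x hx
      have : ζ x = 0 := by
        by_contra hne
        exact hs (subset_tsupport ζ hne) hx
      simp [this]
    have h1 : ∫ x, φ x * lap (fun x => (ζ x : ℂ)) x = ((∫ x, ψ x * lap ζ x : ℝ) : ℂ) := by
      rw [← integral_complex_ofReal]
      refine integral_congr_ae (ae_of_all _ fun x => ?_)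
      simp [hφψ, lap_ofReal hζ]
    have h2 : ∫ x, φ x * (ζ x : ℂ) = ((∫ x, ψ x * ζ x : ℝ) : ℂ) := by
      rw [← integral_complex_ofReal]
      refine integral_congr_ae (ae_of_all _ fun x => ?_)
      simp [hφψ]
    rw [h0, h1, h2, mul_zero, add_zero] at hw
    have hw' : (∫ x, ψ x * lap ζ x) + E * ∫ x, ψ x * ζ x = 0 := by exact_mod_cast hw
    linarith

/-- A bound state that is positive on the curve is a ground state. -/
lemma IsBoundState.isGroundState {n : ℕ} (c : Fin n → PlaneCurve) {α E : ℝ} (hα : 0 < α)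
    (hE : E < 0) {u : Plane → ℂ} (hu : IsEigenfunction α (surfaceMeasure c) E u)
    {ψ : Plane → ℝ} (h : IsBoundState α (-E) (surfaceMeasure c) (support c) ψ)
    (hpos : ∀ x ∈ support c, 0 < ψ x) : IsGroundState α (surfaceMeasure c) u := by
  refine ⟨E, hu, fun E' v hv => ?_⟩
  -- An eigenvalue below `E` is again negative, so its eigenfunction also has a potential
  -- representation and is not null on `Γ`.
  by_contra! hlt
  obtain ⟨φ, -, -, -, hφL, hφeq, hφne, -⟩ := exists_representative c (hlt.trans hE) hv
  have hsup : ∀ᵐ x ∂(surfaceMeasure c), x ∈ support c := surfaceMeasure_compl_support c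
  exact hφne (h.ae_eq_zero_of_lt (isDiffuse_surfaceMeasure c) hα (by linarith) (by linarith)
    (hsup.mono hpos) hφL hφeq)

/-- The curve may have several components, so the intermediate value theorem is applied on the
connected convex hull. -/
lemma pos_or_neg_of_ne_zero {s : Set Plane} {ψ : Plane → ℝ} (hψ : Continuous ψ)
    (h : ∀ x ∈ convexHull ℝ s, ψ x ≠ 0) : (∀ x ∈ s, 0 < ψ x) ∨ ∀ x ∈ s, ψ x < 0 := by
  by_contra! hcon
  obtain ⟨⟨x, hx, hx0⟩, y, hy, hy0⟩ := hcon
  obtain ⟨z, hz, hz0⟩ := (convex_convexHull ℝ s).isPreconnected.intermediate_value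
    (subset_convexHull ℝ s hx) (subset_convexHull ℝ s hy) hψ.continuousOn ⟨hx0, hy0⟩
  exact h z hz hz0

end LeakyCurve

/-! ### The main theorem -/

theorem proposition5p3 {n : ℕ} (c : Fin n → LeakyCurve.PlaneCurve)
    (hdisj : ∀ i j, i ≠ j → Disjoint (c i).range (c j).range)
    (α : ℝ) (hα : 0 < α) (E : ℝ) (hE : E < 0) (u : LeakyCurve.Plane → ℝ)
    (hu : LeakyCurve.IsEigenfunction α (LeakyCurve.surfaceMeasure c) E (fun x => (u x : ℂ))) :
    -- `ψ` is the (unique) continuous representative of the eigenfunction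
    ∃ ψ : LeakyCurve.Plane → ℝ, Continuous ψ ∧ ψ =ᵐ[volume] u ∧
      -- every maximum point and every minimum point lies on `Γ`
      (∀ x, (∀ y, ψ y ≤ ψ x) → x ∈ LeakyCurve.support c) ∧
      (∀ x, (∀ y, ψ x ≤ ψ y) → x ∈ LeakyCurve.support c) ∧
      -- so do the positive local maxima and the negative local minima
      (∀ x, IsLocalMax ψ x → 0 < ψ x → x ∈ LeakyCurve.support c) ∧
      (∀ x, IsLocalMin ψ x → ψ x < 0 → x ∈ LeakyCurve.support c) ∧
      -- a positive supremum and a negative infimum are attained on `Γ`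
      ((∃ y, 0 < ψ y) → ∃ x ∈ LeakyCurve.support c, ∀ y, ψ y ≤ ψ x) ∧
      ((∃ y, ψ y < 0) → ∃ x ∈ LeakyCurve.support c, ∀ y, ψ x ≤ ψ y) ∧
      -- an eigenfunction that is not the ground state has a zero in the convex hull of `Γ`
      (¬ LeakyCurve.IsGroundState α (LeakyCurve.surfaceMeasure c) (fun x => (u x : ℂ)) →
        ∃ x ∈ convexHull ℝ (LeakyCurve.support c), ψ x = 0) := by
  obtain ⟨ψ, hψu, h⟩ := LeakyCurve.exists_isBoundState c hE hu
  have hm : 0 < -E := by linarith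
  have hσ := LeakyCurve.isDiffuse_surfaceMeasure c
  have hΓ : IsClosed (LeakyCurve.support c) := (LeakyCurve.isCompact_support c).isClosed
  refine ⟨ψ, h.continuous, hψu, fun x hx => h.mem_of_isMax hσ hα hΓ hm hx,
    fun x hx => h.neg.mem_of_isMax hσ hα hΓ hm fun y => neg_le_neg (hx y),
    fun x hx hpos => h.mem_of_isLocalMax hΓ hm hx hpos,
    fun x hx hneg => h.neg.mem_of_isLocalMax hΓ hm hx.neg (neg_pos.2 hneg),
    fun hpos => h.exists_isMax hσ hα hΓ hm hpos, fun ⟨y, hy⟩ => ?_, fun hng => ?_⟩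
  · obtain ⟨x, hx, hmax⟩ := h.neg.exists_isMax hσ hα hΓ hm ⟨y, neg_pos.2 hy⟩
    exact ⟨x, hx, fun y => neg_le_neg_iff.1 (hmax y)⟩
  · by_contra! hne
    rcases LeakyCurve.pos_or_neg_of_ne_zero h.continuous hne with hp | hn
    · exact hng (h.isGroundState c hα hE hu hp)
    -- The ground state criterion needs only some bound state at energy `E` that is positive on `Γ`;
    -- here `-ψ` certifies it for `u` itself.
    · exact hng (h.neg.isGroundState c hα hE hu fun x hx => neg_pos.2 (hn x hx))
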